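/- **Setting.** Let $\mathcal P$ be a finite set of processes. A fail-prone system is a collection of subsets of $\mathcal P$, none contained in another; $\mathcal A^*$ denotes the collection of all subsets of members of $\mathcal A$. Let $\mathbb F=[\mathcal F_i]_{p_i\in\mathcal P}$ be an array of fail-prone systems and $\mathbb Q=[\mathcal Q_i]_{p_i\in\mathcal P}$ an asymmetric Byzantine quorum system for $\mathbb F$, i.e. $\mathcal Q_i\subseteq 2^{\mathcal P}$ and: (consistency) for all $i,j$, $Q_i\in\mathcal Q_i$, $Q_j\in\mathcal Q_j$, $F_{ij}\in\mathcal F_i^*\cap\mathcal F_j^*$ we have $Q_i\cap Q_j\not\subseteq F_{ij}$; (availability) for all $i$ and $F_i\in\mathcal F_i$ there is $Q_i\in\mathcal Q_i$ with $F_i\cap Q_i=\emptyset$. A core set for $p_i$ is a minimal set among the sets $C\subseteq\mathcal P$ that satisfy $C\not\subseteq F_i$ for all $F_i\in\mathcal F_i$; $\mathcal C_i$ is the collection of all core sets for $p_i$. In an execution with set $F$ of faulty processes, the other processes are correct, and $p_i$ is wise if it is correct and $F\in\mathcal F_i^*$. **System.** Processes communicate asynchronously over authenticated, reliable FIFO point-to-point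 links (a process also sends to itself when it sends to all). Faulty processes are Byzantine: they may send arbitrary messages, in their own name, at any time. Executions are fair: every message in transit to a correct process is eventually received, and a correct process does not wait forever for a condition that holds. One designated process $p_w$ may invoke $\mathit{write}(x)$, with $x$ in the domain $\mathcal X$; every process may invoke $\mathit{read}$; a correct process invokes an operation only when it has none pending. **Double-write protocol.** Every process $p_i$ stores a pre-written pair $(pts,pv)$ and a written pair $(ts,v)$, both initially $(0,x_0)$, where $x_0\in\mathcal X$ is the initial value of the register; $wts$ and $rid$ are initially $0$. * $\mathit{write}(x)$ at $p_w$: $wts\gets wts+1$; send $[\mathrm{PREWRITE},wts,x]$ to all; wait until the processes of some $Q_w\in\mathcal Q_w$ have answered this message with $[\mathrm{PREACK}]$; send $[\mathrm{WRITE},wts,x]$ to all; wait until the processes of some $Q_w\in\mathcal Q_w$ have answered this message with $[\mathrm{ACK}]$; the write completes. (The $t$-th $[\mathrm{PREACK}]$ or $[\mathrm{ACK}]$ received on a link counts as the answer to the $t$-th PREWRITE or WRITE, respectively.) * $\mathit{read}$ at $p_r$: $rid\gets rid+1$; start with an empty list $readlist$; send $[\mathrm{READ},rid]$ to all. While the read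 is pending, upon receiving $[\mathrm{VALUE},r_j,pts_j,pv_j,ts_j,v_j]$ from $p_j$ with $r_j=rid$ and ($pts_j=ts_j+1$ or $(pts_j,pv_j)=(ts_j,v_j)$): set $readlist[j]\gets(pts_j,pv_j,ts_j,v_j)$; if there are $(ts^*,v^*)$, $C_r\in\mathcal C_r$ and $Q_r\in\mathcal Q_r$ such that every $p_k\in C_r$ has an entry $readlist[k]=(pts_k,pv_k,ts_k,v_k)$ with $(pts_k,pv_k)=(ts^*,v^*)$ or $(ts_k,v_k)=(ts^*,v^*)$, and every $p_k\in Q_r$ has an entry with $ts_k<ts^*$ or $(pts_k,pv_k)=(ts^*,v^*)$ or $(ts_k,v_k)=(ts^*,v^*)$, then the read returns $v^*$ for some such pair and completes; otherwise send $[\mathrm{READ},rid]$ to all. * Every process, upon receiving $[\mathrm{PREWRITE},t,x]$ from $p_w$ with $t=pts+1$ and $pts=ts$: $(pts,pv)\gets(t,x)$, send $[\mathrm{PREACK}]$ to $p_w$. Upon receiving $[\mathrm{WRITE},t,x]$ from $p_w$ with $t=pts$ and $x=pv$: $(ts,v)\gets(t,x)$, send $[\mathrm{ACK}]$ to $p_w$.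 Upon receiving $[\mathrm{READ},r]$ from $p_r$: send $[\mathrm{VALUE},r,pts,pv,ts,v]$ to $p_r$. Messages that do not satisfy the stated conditions on receipt are ignored. **Theorem.** This protocol emulates an asymmetric Byzantine SWMR regular register for wise readers and writer, provided there are only finitely many write operations. That is, in every fair execution, with any set $F$ of faulty processes for which $p_w$ is wise and with only finitely many write invocations: * (Liveness) every operation invoked by a wise process eventually completes. * (Safety) every completed read of a wise process returns the value of the most recent write of a wise process that completes before the read is invoked ($x_0$ if there is none), or the value of a write of a wise process that is concurrent with the read; in particular it returns the former value if no write is concurrent with it. (Two operations are concurrent if neither completes before the other is invoked.) -/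

import Mathlib

namespace AsymRegister

/-! ### Asymmetric trust: fail-prone systems, quorums, core sets, wise processes -/

/-- A fail-prone system: a collection of sets of processes, none contained in another. -/
def IsFailProneSystem {P : Type*} (𝓕 : Set (Set P)) : Prop :=
  ∀ A ∈ 𝓕, ∀ B ∈ 𝓕, A ⊆ B → A = B

/-- The collection `𝓐^*` of all subsets of the sets in `𝓐`. -/
def downClosure {P : Type*} (𝓐 : Set (Set P)) : Set (Set P) :=
  {A' | ∃ A ∈ 𝓐, A' ⊆ A}

/-- `𝓠 i` is the quorum system of process `i`; `𝓕 i` is its fail-prone system. -/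
structure IsAsymQuorumSystem {P : Type*} (𝓕 𝓠 : P → Set (Set P)) : Prop where
  consistency : ∀ i j, ∀ Qi ∈ 𝓠 i, ∀ Qj ∈ 𝓠 j,
    ∀ Fij ∈ downClosure (𝓕 i) ∩ downClosure (𝓕 j), ¬ (Qi ∩ Qj ⊆ Fij)
  availability : ∀ i, ∀ Fi ∈ 𝓕 i, ∃ Qi ∈ 𝓠 i, Fi ∩ Qi = ∅

/-- The core set system of a fail-prone system: all sets that are not contained in a fail-prone
set and are minimal in this respect. -/
def coreSets {P : Type*} (𝓕 : Set (Set P)) : Set (Set P) :=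
  {C | (∀ A ∈ 𝓕, ¬ C ⊆ A) ∧ ∀ C', C' ⊂ C → ∃ A ∈ 𝓕, C' ⊆ A}

/-- The wise processes when `F` is the set of faulty processes: correct processes whose trust
assumption foresees `F`. -/
def wise {P : Type*} (𝓕 : P → Set (Set P)) (F : Set P) : Set P :=
  {p | p ∉ F ∧ F ∈ downClosure (𝓕 p)}

/-! ### Histories of a register and the regular register specification -/

/-- Invocations and responses of register operations with domain `X`. -/
inductive RegEvent (X : Type*)
  | writeInv (x : X)
  | writeAck
  | readInv
  | readRet (x : X)

/-- A history in discrete time: at each time at most one register event occurs, at one process. -/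
abbrev History (P X : Type*) := ℕ → Option (P × RegEvent X)

namespace History

variable {P X : Type*} (h : History P X)

/-- `e` occurs at process `p` at time `m`, and is the first event at `p` after time `n`. -/
def NextEvent (p : P) (n m : ℕ) (e : RegEvent X) : Prop :=
  n < m ∧ h m = some (p, e) ∧ ∀ k, n < k → k < m → ∀ e', h k ≠ some (p, e')

/-- A write of `x` by a process of the set `W` is invoked at time `a`. -/
def IsWrite (W : Set P) (a : ℕ) (x : X) : Prop :=
  ∃ q ∈ W, h a = some (q, .writeInv x)

/-- The write invoked at time `a` completes at time `b`. -/
def WriteCompletes (a b : ℕ) : Prop :=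
  ∃ q x, h a = some (q, .writeInv x) ∧ h.NextEvent q a b .writeAck

/-- The read invoked by `p` at time `n` completes at time `m`, returning `x`. -/
def ReadCompletes (p : P) (n m : ℕ) (x : X) : Prop :=
  h n = some (p, .readInv) ∧ h.NextEvent p n m (.readRet x)

/-- The write invoked at time `a` completes before time `n`. -/
def WritePrecedes (a n : ℕ) : Prop := ∃ b, h.WriteCompletes a b ∧ b < n

/-- The write invoked at time `a` is concurrent with the read invoked at time `n` and completed
at time `m`: neither one completes before the other one is invoked. -/
def WriteConcurrent (a n m : ℕ) : Prop := ¬ h.WritePrecedes a n ∧ ¬ m < a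

/-- `x` is the value written by the most recent write (of a process in `W`) that completes before
time `n`, where an imaginary initial write of `x₀` precedes everything. -/
def LastWritten (W : Set P) (x₀ : X) (n : ℕ) (x : X) : Prop :=
  (∃ a, h.IsWrite W a x ∧ h.WritePrecedes a n ∧
    ∀ a' x', h.IsWrite W a' x' → h.WritePrecedes a' n → a' ≤ a) ∨
  (x = x₀ ∧ ∀ a' x', h.IsWrite W a' x' → ¬ h.WritePrecedes a' n)

/-- The asymmetric SWMR regular register, `W` being the set of wise processes. -/
structure IsRegularRegister (W : Set P) (x₀ : X) : Prop where
  write_liveness : ∀ p ∈ W, ∀ n x, h n = some (p, .writeInv x) →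
    ∃ m, h.NextEvent p n m .writeAck
  read_liveness : ∀ p ∈ W, ∀ n, h n = some (p, .readInv) →
    ∃ m x, h.NextEvent p n m (.readRet x)
  safety : ∀ p ∈ W, ∀ n m x, h.ReadCompletes p n m x →
    h.LastWritten W x₀ n x ∨ ∃ a, h.IsWrite W a x ∧ h.WriteConcurrent a n m

/-- Only finitely many writes are invoked. -/
def FinitelyManyWrites : Prop :=
  {n : ℕ | ∃ p x, h n = some (p, .writeInv x)}.Finite

end History

/-! ### The double-write protocol -/

/-- Protocol messages. -/
inductive Msg (X : Type*)
  | prewrite (t : ℕ) (x : X)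
  | preack
  | write (t : ℕ) (x : X)
  | ack
  | read (r : ℕ)
  | value (r pts : ℕ) (pv : X) (ts : ℕ) (v : X)

/-- What a process is currently executing: nothing, a write that waits for `preack` messages,
a write that waits for `ack` messages, or a read. -/
inductive Phase (X : Type*)
  | idle
  | prewriting (x : X)
  | writing (x : X)
  | reading

/-- The last accepted reply of a process to a read. -/
structure Entry (X : Type*) where
  pts : ℕ
  pv : X
  ts : ℕ
  v : X

/-- The local state of a process. `preacks j` and `acks j` count the `preack` and `ack` messages
received from `j`; as links are FIFO, the `t`-th of them answers the `t`-th request to `j`. -/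
structure LocalState (P X : Type*) where
  phase : Phase X
  wts : ℕ
  preacks : P → ℕ
  acks : P → ℕ
  rid : ℕ
  readlist : P → Option (Entry X)
  pts : ℕ
  pv : X
  ts : ℕ
  v : X

/-- Initial local state; `x₀` is the initial value of the register, with timestamp `0`. -/
def LocalState.init (P : Type*) {X : Type*} (x₀ : X) : LocalState P X where
  phase := .idle
  wts := 0
  preacks := fun _ => 0
  acks := fun _ => 0
  rid := 0
  readlist := fun _ => none
  pts := 0
  pv := x₀
  ts := 0
  v := x₀

/-- The entry carries the pair `(t, x)` as its pre-written or as its written pair. -/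
def Entry.Carries {X : Type*} (e : Entry X) (t : ℕ) (x : X) : Prop :=
  (e.pts, e.pv) = (t, x) ∨ (e.ts, e.v) = (t, x)

/-- The return condition of reader `r` for the timestamp/value pair `(t, x)`. -/
def Selects {P X : Type*} (𝓕 𝓠 : P → Set (Set P)) (r : P) (readlist : P → Option (Entry X))
    (t : ℕ) (x : X) : Prop :=
  (∃ C ∈ coreSets (𝓕 r), C ⊆ {k | ∃ e, readlist k = some e ∧ e.Carries t x}) ∧
  (∃ Q ∈ 𝓠 r, Q ⊆ {k | ∃ e, readlist k = some e ∧ (e.ts < t ∨ e.Carries t x)})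

/-- The messages that a step sends, listed by destination. -/
abbrev Outbox (P X : Type*) := P → List (Msg X)

/-- Send nothing. -/
def Outbox.silent {P X : Type*} : Outbox P X := fun _ => []

/-- Send `m` to all processes (the sender included). -/
def Outbox.toAll {P X : Type*} (m : Msg X) : Outbox P X := fun _ => [m]

/-- Send `m` to `j`. -/
def Outbox.to {P X : Type*} [DecidableEq P] (j : P) (m : Msg X) : Outbox P X :=
  fun k => if k = j then [m] else []

/-- The condition under which a reader in state `s` accepts a `value` message. -/
def AcceptsValue {P X : Type*} (s : LocalState P X) (r : ℕ) (e : Entry X) : Prop :=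
  s.phase = .reading ∧ r = s.rid ∧ (e.pts = e.ts + 1 ∨ (e.pts, e.pv) = (e.ts, e.v))

/-- `Receive 𝓕 𝓠 w i j s m s' out res`: correct process `i` in state `s` receives message `m` from
`j`, moves to state `s'` and sends `out`; `res = some x` if its pending read returns `x`. The writer
is `w`. -/
inductive Receive {P X : Type*} [DecidableEq P] (𝓕 𝓠 : P → Set (Set P)) (w i j : P)
    (s : LocalState P X) : Msg X → LocalState P X → Outbox P X → Option X → Prop
  | prewrite (t : ℕ) (x : X) (hg : j = w ∧ t = s.pts + 1 ∧ s.pts = s.ts) :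
      Receive 𝓕 𝓠 w i j s (.prewrite t x) { s with pts := t, pv := x } (.to w .preack) none
  | prewriteIgnored (t : ℕ) (x : X) (hg : ¬ (j = w ∧ t = s.pts + 1 ∧ s.pts = s.ts)) :
      Receive 𝓕 𝓠 w i j s (.prewrite t x) s .silent none
  | write (t : ℕ) (x : X) (hg : j = w ∧ t = s.pts ∧ x = s.pv) :
      Receive 𝓕 𝓠 w i j s (.write t x) { s with ts := t, v := x } (.to w .ack) none
  | writeIgnored (t : ℕ) (x : X) (hg : ¬ (j = w ∧ t = s.pts ∧ x = s.pv)) :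
      Receive 𝓕 𝓠 w i j s (.write t x) s .silent none
  | preack :
      Receive 𝓕 𝓠 w i j s .preack
        { s with preacks := Function.update s.preacks j (s.preacks j + 1) } .silent none
  | ack :
      Receive 𝓕 𝓠 w i j s .ack
        { s with acks := Function.update s.acks j (s.acks j + 1) } .silent none
  | read (r : ℕ) :
      Receive 𝓕 𝓠 w i j s (.read r) s (.to j (.value r s.pts s.pv s.ts s.v)) none
  | valueReturn (r pts : ℕ) (pv : X) (ts : ℕ) (v : X) (t : ℕ) (x : X)
      (hg : AcceptsValue s r ⟨pts, pv, ts, v⟩)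
      (hsel : Selects 𝓕 𝓠 i (Function.update s.readlist j (some ⟨pts, pv, ts, v⟩)) t x) :
      Receive 𝓕 𝓠 w i j s (.value r pts pv ts v)
        { s with
          readlist := Function.update s.readlist j (some ⟨pts, pv, ts, v⟩)
          phase := .idle } .silent (some x)
  | valueRetry (r pts : ℕ) (pv : X) (ts : ℕ) (v : X)
      (hg : AcceptsValue s r ⟨pts, pv, ts, v⟩)
      (hsel : ∀ t x,
        ¬ Selects 𝓕 𝓠 i (Function.update s.readlist j (some ⟨pts, pv, ts, v⟩)) t x) :
      Receive 𝓕 𝓠 w i j s (.value r pts pv ts v)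
        { s with readlist := Function.update s.readlist j (some ⟨pts, pv, ts, v⟩) }
        (.toAll (.read s.rid)) none
  | valueIgnored (r pts : ℕ) (pv : X) (ts : ℕ) (v : X)
      (hg : ¬ AcceptsValue s r ⟨pts, pv, ts, v⟩) :
      Receive 𝓕 𝓠 w i j s (.value r pts pv ts v) s .silent none

/-! ### Executions of the protocol with Byzantine processes -/

/-- Global state: local states, and the FIFO queue `chan j i` of messages in transit from `j`
to `i` (oldest message first). -/
structure GlobalState (P X : Type*) where
  proc : P → LocalState P X
  chan : P → P → List (Msg X)

/-- The initial state: every process in its initial state, no message in transit. -/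
def GlobalState.init (P : Type*) {X : Type*} (x₀ : X) : GlobalState P X where
  proc := fun _ => LocalState.init P x₀
  chan := fun _ _ => []

/-- Replace the queue from `j` to `i`. -/
def GlobalState.setChan {P X : Type*} [DecidableEq P] (g : GlobalState P X) (j i : P)
    (q : List (Msg X)) : GlobalState P X :=
  { g with chan := Function.update g.chan j (Function.update (g.chan j) i q) }

/-- Process `i` moves to local state `s` and sends the messages in `out`. -/
def GlobalState.act {P X : Type*} [DecidableEq P] (g : GlobalState P X) (i : P)
    (s : LocalState P X) (out : Outbox P X) : GlobalState P X where
  proc := Function.update g.proc i s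
  chan := Function.update g.chan i (fun k => g.chan i k ++ out k)

/-- The kinds of steps. `deliver j i res` is the receipt by `i` of the oldest message in transit
from `j`; `res = some x` if this makes the pending read of `i` return `x`. `byzSend i j m` is the
sending of an arbitrary message by a faulty process. -/
inductive Label (P X : Type*)
  | stutter
  | invokeWrite (x : X)
  | prewriteDone
  | writeDone
  | invokeRead (i : P)
  | deliver (j i : P) (res : Option X)
  | byzSend (i j : P) (m : Msg X)

/-- In state `s`, the writer `w` waits for `preack` messages, and all processes in some quorum for
`w` have answered the current `prewrite` message. -/
def PreackQuorum {P X : Type*} (𝓠 : P → Set (Set P)) (w : P) (s : LocalState P X) : Prop :=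
  (∃ x, s.phase = .prewriting x) ∧ ∃ Q ∈ 𝓠 w, ∀ j ∈ Q, s.wts ≤ s.preacks j

/-- In state `s`, the writer `w` waits for `ack` messages, and all processes in some quorum for
`w` have answered the current `write` message. -/
def AckQuorum {P X : Type*} (𝓠 : P → Set (Set P)) (w : P) (s : LocalState P X) : Prop :=
  (∃ x, s.phase = .writing x) ∧ ∃ Q ∈ 𝓠 w, ∀ j ∈ Q, s.wts ≤ s.acks j

/-- The steps of the system in which `w` is the writer and `F` the set of faulty processes. Correct
processes follow the protocol and invoke an operation only when no operation of theirs is pending;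
only the writer writes; faulty processes may send anything at any time, in their own name. -/
inductive Step {P X : Type*} [DecidableEq P] (𝓕 𝓠 : P → Set (Set P)) (w : P) (F : Set P)
    (g : GlobalState P X) : Label P X → GlobalState P X → Prop
  | stutter : Step 𝓕 𝓠 w F g .stutter g
  | invokeWrite (x : X) (hw : w ∉ F) (hph : (g.proc w).phase = .idle) :
      Step 𝓕 𝓠 w F g (.invokeWrite x)
        (g.act w { g.proc w with wts := (g.proc w).wts + 1, phase := .prewriting x }
          (.toAll (.prewrite ((g.proc w).wts + 1) x)))
  | prewriteDone (x : X) (hw : w ∉ F) (hph : (g.proc w).phase = .prewriting x)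
      (hq : PreackQuorum 𝓠 w (g.proc w)) :
      Step 𝓕 𝓠 w F g .prewriteDone
        (g.act w { g.proc w with phase := .writing x } (.toAll (.write (g.proc w).wts x)))
  | writeDone (hw : w ∉ F) (hq : AckQuorum 𝓠 w (g.proc w)) :
      Step 𝓕 𝓠 w F g .writeDone (g.act w { g.proc w with phase := .idle } .silent)
  | invokeRead (i : P) (hi : i ∉ F) (hph : (g.proc i).phase = .idle) :
      Step 𝓕 𝓠 w F g (.invokeRead i)
        (g.act i
          { g.proc i with
            rid := (g.proc i).rid + 1
            readlist := fun _ => none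
            phase := .reading }
          (.toAll (.read ((g.proc i).rid + 1))))
  | deliver (j i : P) (m : Msg X) (rest : List (Msg X)) (s' : LocalState P X) (out : Outbox P X)
      (res : Option X) (hi : i ∉ F) (hm : g.chan j i = m :: rest)
      (hr : Receive 𝓕 𝓠 w i j (g.proc i) m s' out res) :
      Step 𝓕 𝓠 w F g (.deliver j i res) ((g.setChan j i rest).act i s' out)
  | deliverFaulty (j i : P) (m : Msg X) (rest : List (Msg X)) (hi : i ∈ F)
      (hm : g.chan j i = m :: rest) :
      Step 𝓕 𝓠 w F g (.deliver j i none) (g.setChan j i rest)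
  | byzSend (i j : P) (m : Msg X) (hi : i ∈ F) :
      Step 𝓕 𝓠 w F g (.byzSend i j m) (g.setChan i j (g.chan i j ++ [m]))

/-- The register event, if any, that a step represents. -/
def Label.event {P X : Type*} (w : P) : Label P X → Option (P × RegEvent X)
  | .invokeWrite x => some (w, .writeInv x)
  | .writeDone => some (w, .writeAck)
  | .invokeRead i => some (i, .readInv)
  | .deliver _ i (some x) => some (i, .readRet x)
  | _ => none

/-- An infinite execution of the protocol (possibly stuttering): step `n` is labelled `step n` and
leads from `state n` to `state (n + 1)`. -/
structure Execution {P X : Type*} [DecidableEq P] (𝓕 𝓠 : P → Set (Set P)) (w : P) (x₀ : X)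
    (F : Set P) where
  state : ℕ → GlobalState P X
  step : ℕ → Label P X
  init : state 0 = GlobalState.init P x₀
  next : ∀ n, Step 𝓕 𝓠 w F (state n) (step n) (state (n + 1))

namespace Execution

variable {P X : Type*} [DecidableEq P] {𝓕 𝓠 : P → Set (Set P)} {w : P} {x₀ : X} {F : Set P}

/-- Fairness: every message in transit to a correct process is eventually received, and a correct
writer does not wait forever once the condition that it waits for holds. -/
structure Fair (σ : Execution 𝓕 𝓠 w x₀ F) : Prop where
  delivery : ∀ j i, i ∉ F → ∀ n, (∀ m, n ≤ m → (σ.state m).chan j i ≠ []) →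
    ∃ m, n ≤ m ∧ ∃ res, σ.step m = .deliver j i res
  prewriteDone : w ∉ F → ∀ n, (∀ m, n ≤ m → PreackQuorum 𝓠 w ((σ.state m).proc w)) →
    ∃ m, n ≤ m ∧ σ.step m = .prewriteDone
  writeDone : w ∉ F → ∀ n, (∀ m, n ≤ m → AckQuorum 𝓠 w ((σ.state m).proc w)) →
    ∃ m, n ≤ m ∧ σ.step m = .writeDone

/-- The history of an execution. -/
def history (σ : Execution 𝓕 𝓠 w x₀ F) : History P X := fun n => (σ.step n).event w

end Execution

end AsymRegister

/-! The writer sends every process one fixed stream: PREWRITE 1, WRITE 1, PREWRITE 2, WRITE 2, and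
so on. At a correct replica `ts ≤ pts ≤ ts + 1`, and `pts + ts` is the number of stream messages
processed so far: its parity tells which kind comes next. Since links are FIFO, the writer's
messages still in transit are exactly the rest of the stream (`ReplicaInv`), so a correct replica
never ignores one of them. Its acknowledgements, counted or in transit, number exactly `pts` and
`ts`. Hence every reply of a correct process is `Genuine`: it reports pairs `(t, val t)` with
consecutive or equal timestamps of invoked writes.

Safety. A core set contains a correct process, so the selected pair is `(t, val t)` for some invoked
write `t` or for the initial value. The reader's quorum meets the quorum that acknowledged the last
completed write in a correct process, which replied after the read was invoked
(`IsVal.fresh_replies`). Its entry therefore has a `ts` at least the number `c` of writes completed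
by then (`IsVal.completed_quorum`), and the quorum condition gives `t ≥ c`. If `t = c`, the value is
the last written one; if `t > c`, write `t` is concurrent with the read.

Liveness. By fairness correct replicas catch up with the stream (`Fair.catch_up`), and availability
provides a quorum of correct processes, so both waits of a write end. With finitely many writes all
correct replicas eventually hold the same pair twice (`Fair.eventually_stable`). A read that never
returned would keep a request or a reply in transit for each correct process, because each accepted
reply triggers new requests. Once old replies are flushed from the FIFO links, all correct entries
agree; a quorum and a core set of correct processes then satisfy the return condition, a
contradiction. Finiteness of the writes is needed only here. -/

namespace AsymRegister

/-! ### The message stream of the writer -/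

section Step

variable {P X : Type*}

/-- The number of `prewrite` and `write` messages that a writer in this state has sent to each
process. -/
def LocalState.sent (s : LocalState P X) : ℕ :=
  match s.phase with
  | .prewriting _ => 2 * s.wts - 1
  | _ => 2 * s.wts

/-- The number of writes that a writer in this state has completed. -/
def LocalState.completed (s : LocalState P X) : ℕ :=
  match s.phase with
  | .prewriting _ => s.wts - 1
  | .writing _ => s.wts - 1
  | _ => s.wts

/-- The process is executing a write. -/
def LocalState.Busy (s : LocalState P X) : Prop :=
  (∃ x, s.phase = .prewriting x) ∨ ∃ x, s.phase = .writing x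

/-- Messages of the two phases of a write. -/
def Msg.isWriter : Msg X → Bool
  | .prewrite _ _ => true
  | .write _ _ => true
  | _ => false

/-- The `preack` message. -/
def Msg.isPreack : Msg X → Bool
  | .preack => true
  | _ => false

/-- The `ack` message. -/
def Msg.isAck : Msg X → Bool
  | .ack => true
  | _ => false

/-- The message that the writer sends to each process after `k` such messages, if `val t` is the
value of its `t`-th write. -/
def writerMsg (val : ℕ → X) (k : ℕ) : Msg X :=
  if k % 2 = 0 then .prewrite (k / 2 + 1) (val (k / 2 + 1))
  else .write (k / 2 + 1) (val (k / 2 + 1))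

/-- The messages of the writer number `a` to `b - 1`. -/
def writerMsgs (val : ℕ → X) (a b : ℕ) : List (Msg X) :=
  (List.range' a (b - a)).map (writerMsg val)

theorem writerMsgs_self (val : ℕ → X) (a : ℕ) : writerMsgs val a a = [] := by
  simp [writerMsgs]

theorem writerMsgs_concat (val : ℕ → X) {a b : ℕ} (h : a ≤ b) :
    writerMsgs val a (b + 1) = writerMsgs val a b ++ [writerMsg val b] := by
  have : b + 1 - a = (b - a) + 1 := by omega
  simp only [writerMsgs, this, List.range'_concat, List.map_append]
  simp; congr; omega

theorem writerMsgs_cons (val : ℕ → X) {a b : ℕ} (h : a < b) :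
    writerMsgs val a b = writerMsg val a :: writerMsgs val (a + 1) b := by
  have : b - a = (b - (a + 1)) + 1 := by omega
  simp [writerMsgs, this, List.range'_succ]

theorem writerMsg_isWriter (val : ℕ → X) (k : ℕ) : (writerMsg val k).isWriter = true := by
  unfold writerMsg; split <;> rfl

variable [DecidableEq P] {𝓕 𝓠 : P → Set (Set P)} {w : P} {F : Set P} {g g' : GlobalState P X}
  {l : Label P X}

/-! ### Effect of one step on channels and counters -/

theorem GlobalState.act_proc (g : GlobalState P X) (i k : P) (s : LocalState P X)
    (out : Outbox P X) : (g.act i s out).proc k = if k = i then s else g.proc k := by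
  simp [GlobalState.act, Function.update_apply]

theorem GlobalState.act_chan (g : GlobalState P X) (i a b : P) (s : LocalState P X)
    (out : Outbox P X) :
    (g.act i s out).chan a b = if a = i then g.chan a b ++ out b else g.chan a b := by
  by_cases h : a = i
  · subst h; simp [GlobalState.act]
  · simp [GlobalState.act, h]

theorem GlobalState.setChan_proc (g : GlobalState P X) (j i k : P) (q : List (Msg X)) :
    (g.setChan j i q).proc k = g.proc k := rfl

theorem GlobalState.setChan_chan (g : GlobalState P X) (j i a b : P) (q : List (Msg X)) :
    (g.setChan j i q).chan a b = if a = j ∧ b = i then q else g.chan a b := by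
  by_cases h : a = j
  · subst h
    by_cases h' : b = i <;> simp [GlobalState.setChan, h']
  · simp [GlobalState.setChan, h]

/-- A step with label `l` changes the channel from `j` to `i` from `q` to `q'` by appending `out`,
and by removing the oldest message if it delivers one on this channel. -/
def ChanStep (l : Label P X) (j i : P) (q q' out : List (Msg X)) : Prop :=
  (∃ res m, l = .deliver j i res ∧ ∃ rest, q = m :: rest ∧ q' = rest ++ out) ∨
    (∀ res, l ≠ .deliver j i res) ∧ q' = q ++ out

/-- How a step changes a channel: the oldest message may be delivered, and messages may be
appended; those appended by a correct process report its state truthfully. -/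
theorem Step.chan_cases (h : Step 𝓕 𝓠 w F g l g') (j i : P) :
    ∃ out, ChanStep l j i (g.chan j i) (g'.chan j i) out ∧
      (j ∉ F →
        (∀ r a b c d, Msg.value r a b c d ∈ out →
          a = (g.proc j).pts ∧ b = (g.proc j).pv ∧ c = (g.proc j).ts ∧ d = (g.proc j).v ∧
            .read r ∈ g.chan i j) ∧
        ∀ r, Msg.read r ∈ out → r = (g'.proc j).rid) := by
  cases h with
  | stutter => exact ⟨[], by simp [ChanStep]⟩
  | invokeWrite x hw hph =>
    by_cases hj : j = w
    · exact ⟨[.prewrite ((g.proc w).wts + 1) x], by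
        simp [ChanStep, GlobalState.act_chan, hj, Outbox.toAll]⟩
    · exact ⟨[], by simp [ChanStep, GlobalState.act_chan, hj]⟩
  | prewriteDone x hw hph hq =>
    by_cases hj : j = w
    · exact ⟨[.write (g.proc w).wts x], by simp [ChanStep, GlobalState.act_chan, hj, Outbox.toAll]⟩
    · exact ⟨[], by simp [ChanStep, GlobalState.act_chan, hj]⟩
  | writeDone hw hq => exact ⟨[], by simp [ChanStep, GlobalState.act_chan, Outbox.silent]⟩
  | invokeRead k hk hph =>
    by_cases hj : j = k
    · exact ⟨[.read ((g.proc k).rid + 1)], by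
        simp [ChanStep, GlobalState.act_chan, GlobalState.act_proc, hj, Outbox.toAll]⟩
    · exact ⟨[], by simp [ChanStep, GlobalState.act_chan, hj]⟩
  | deliver b k m rest s' out res hk hm hr =>
    refine ⟨if j = k then out i else [], ?_, ?_⟩
    · by_cases hb : j = b ∧ i = k
      · left
        obtain ⟨rfl, rfl⟩ := hb
        refine ⟨res, m, rfl, rest, hm, ?_⟩
        rw [GlobalState.act_chan, GlobalState.setChan_chan]
        split_ifs <;> simp_all
      · right
        refine ⟨?_, ?_⟩
        · rintro r hr'
          cases hr'
          exact hb ⟨rfl, rfl⟩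
        · rw [GlobalState.act_chan, GlobalState.setChan_chan]
          split_ifs <;> simp_all
    · intro hj
      by_cases hjk : j = k
      · subst hjk
        cases hr <;>
          simp [GlobalState.act_proc, Outbox.silent, Outbox.to, Outbox.toAll]
        grind
      · simp [hjk]
  | deliverFaulty b k m rest hk hm =>
    refine ⟨[], ?_, by simp⟩
    by_cases hb : j = b ∧ i = k
    · left
      obtain ⟨rfl, rfl⟩ := hb
      exact ⟨none, m, rfl, rest, hm, by simp [GlobalState.setChan_chan]⟩
    · right
      refine ⟨?_, ?_⟩
      · rintro r hr'
        cases hr'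
        exact hb ⟨rfl, rfl⟩
      · rw [GlobalState.setChan_chan]; simp [hb]
  | byzSend b k m hb =>
    by_cases hbk : j = b ∧ i = k
    · obtain ⟨rfl, rfl⟩ := hbk
      exact ⟨[m], by simp [ChanStep, GlobalState.setChan_chan], fun h => (h hb).elim⟩
    · exact ⟨[], by simp [ChanStep, GlobalState.setChan_chan, hbk]⟩

/-- Write timestamps, read identifiers and acknowledgement counters never decrease. -/
theorem Step.counters_le (h : Step 𝓕 𝓠 w F g l g') (i : P) :
    (g.proc i).wts ≤ (g'.proc i).wts ∧ (g.proc i).rid ≤ (g'.proc i).rid ∧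
      (∀ j, (g.proc i).preacks j ≤ (g'.proc i).preacks j) ∧
      ∀ j, (g.proc i).acks j ≤ (g'.proc i).acks j := by
  cases h with
  | deliver b k m rest s' out res hk hm hr =>
    rw [GlobalState.act_proc, GlobalState.setChan_proc]
    split_ifs with hik
    · subst hik
      cases hr <;> simp [Function.update_apply] <;> intro j <;> split_ifs <;> simp_all
    · simp
  | stutter => simp
  | deliverFaulty => simp [GlobalState.setChan_proc]
  | byzSend => simp [GlobalState.setChan_proc]
  | _ =>
    rw [GlobalState.act_proc]
    split_ifs with hi
    · simp [hi]
    · simp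

theorem Step.deliver_inv {j i : P} {res : Option X} (h : Step 𝓕 𝓠 w F g (.deliver j i res) g')
    (hi : i ∉ F) : ∃ m rest s' out, g.chan j i = m :: rest ∧
      Receive 𝓕 𝓠 w i j (g.proc i) m s' out res ∧ g' = (g.setChan j i rest).act i s' out := by
  cases h with
  | deliver _ _ m rest s' out _ _ hm hr => exact ⟨m, rest, s', out, hm, hr, rfl⟩
  | deliverFaulty _ _ _ _ hi' => exact (hi hi').elim

/-! ### Invariants of the writer and of a correct replica -/

/-- What is invariant about the writer. -/
structure WriterInv (val : ℕ → X) (w : P) (g : GlobalState P X) : Prop where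
  prewriting : ∀ x, (g.proc w).phase = .prewriting x → 0 < (g.proc w).wts ∧ x = val (g.proc w).wts
  writing : ∀ x, (g.proc w).phase = .writing x → 0 < (g.proc w).wts ∧ x = val (g.proc w).wts

/-- What is invariant about a correct process `i` in its role as a replica: it has received a
prefix of the messages of the writer, and has answered each of them. -/
structure ReplicaInv (val : ℕ → X) (w i : P) (g : GlobalState P X) : Prop where
  pending : (g.chan w i).filter Msg.isWriter =
    writerMsgs val ((g.proc i).pts + (g.proc i).ts) (g.proc w).sent
  le_sent : (g.proc i).pts + (g.proc i).ts ≤ (g.proc w).sent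
  ts_le : (g.proc i).ts ≤ (g.proc i).pts
  pts_le : (g.proc i).pts ≤ (g.proc i).ts + 1
  pv_eq : (g.proc i).pv = val (g.proc i).pts
  v_eq : (g.proc i).v = val (g.proc i).ts
  preacks_add : (g.proc w).preacks i + (g.chan i w).countP Msg.isPreack = (g.proc i).pts
  acks_add : (g.proc w).acks i + (g.chan i w).countP Msg.isAck = (g.proc i).ts

theorem WriterInv.step {val : ℕ → X} (h : Step 𝓕 𝓠 w F g l g') (hg : WriterInv val w g)
    (hval : ∀ x, l = .invokeWrite x → val ((g.proc w).wts + 1) = x) : WriterInv val w g' := by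
  obtain ⟨h1, h2⟩ := hg
  cases h with
  | deliver b k m rest s' out res hk hm hr =>
    constructor <;> simp only [GlobalState.act_proc, GlobalState.setChan_proc] <;>
      split_ifs with hik <;> first | assumption | skip
    all_goals
      subst hik
      cases hr <;> simp_all
  | stutter => exact ⟨h1, h2⟩
  | deliverFaulty => exact ⟨h1, h2⟩
  | byzSend => exact ⟨h1, h2⟩
  | invokeWrite x hw hph => constructor <;> simp [GlobalState.act_proc, hval x rfl]
  | prewriteDone x hw hph hq =>
    have := h1 x hph
    constructor <;> simp [GlobalState.act_proc, this]
  | writeDone => constructor <;> simp [GlobalState.act_proc]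
  | invokeRead k =>
    constructor <;> rw [GlobalState.act_proc] <;> split_ifs <;> first | assumption | simp

theorem Receive.sent_eq {i j : P} {s s' : LocalState P X} {m : Msg X} {out : Outbox P X}
    {res : Option X} (h : Receive 𝓕 𝓠 w i j s m s' out res) :
    s'.sent = s.sent ∧ s'.completed = s.completed ∧ s'.wts = s.wts := by
  cases h with
  -- The only phase change caused by a delivery is from reading to idle, and both phases mean that
  -- no write is pending.
  | valueReturn r pts pv ts v t x hg hsel =>
    simp [LocalState.sent, LocalState.completed, hg.1]
  | _ => simp [LocalState.sent, LocalState.completed]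

theorem Receive.filter_out {i j : P} {s s' : LocalState P X} {m : Msg X} {out : Outbox P X}
    {res : Option X} (h : Receive 𝓕 𝓠 w i j s m s' out res) (k : P) :
    (out k).filter Msg.isWriter = [] := by
  cases h <;> simp [Outbox.silent, Outbox.to, Outbox.toAll, Msg.isWriter]

/-- The effect of a delivery on the replica state of the receiver. -/
theorem Receive.replica_cases {val : ℕ → X} {i j : P} {s s' : LocalState P X} {m : Msg X}
    {out : Outbox P X} {res : Option X} (h : Receive 𝓕 𝓠 w i j s m s' out res)
    (hts : s.ts ≤ s.pts) (hpts : s.pts ≤ s.ts + 1) (hpv : s.pv = val s.pts)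
    (hv : s.v = val s.ts) (hm : j = w → m.isWriter = true → m = writerMsg val (s.pts + s.ts)) :
    s'.ts ≤ s'.pts ∧ s'.pts ≤ s'.ts + 1 ∧ s'.pv = val s'.pts ∧ s'.v = val s'.ts ∧
      s'.pts + s'.ts = s.pts + s.ts + (if j = w ∧ m.isWriter = true then 1 else 0) ∧
      s'.pts = s.pts + (out w).countP Msg.isPreack ∧ s'.ts = s.ts + (out w).countP Msg.isAck := by
  -- Message number `pts + ts` of the stream is PREWRITE `pts + 1` when the timestamps agree and
  -- WRITE `pts` when `pts` is one ahead. This is what the receipt conditions ask for, so the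
  -- ignoring branches are impossible for messages of the writer.
  have hA : s.pts = s.ts ∧ (s.pts + s.ts) % 2 = 0 ∧ (s.pts + s.ts) / 2 + 1 = s.pts + 1 ∨
      s.pts = s.ts + 1 ∧ (s.pts + s.ts) % 2 = 1 ∧ (s.pts + s.ts) / 2 + 1 = s.pts := by omega
  cases h with
  | prewrite t x hg =>
    obtain ⟨rfl, rfl, h3⟩ := hg
    have := hm rfl rfl
    rcases hA with ⟨hA1, hA2, hA3⟩ | ⟨hA1, hA2, hA3⟩
    · simp [writerMsg, hA2, hA3] at this
      simp [Outbox.to, Msg.isWriter, Msg.isPreack, Msg.isAck, this, hv]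
      omega
    · omega
  | prewriteIgnored t x hg =>
    by_cases hj : j = w
    · have := hm hj rfl
      rcases hA with ⟨hA1, hA2, hA3⟩ | ⟨hA1, hA2, hA3⟩
      · simp [writerMsg, hA2, hA3] at this
        exact (hg ⟨hj, this.1, hA1⟩).elim
      · simp [writerMsg, hA2] at this
    · simp [Outbox.silent, *]
  | write t x hg =>
    obtain ⟨rfl, rfl, h3⟩ := hg
    have := hm rfl rfl
    rcases hA with ⟨hA1, hA2, hA3⟩ | ⟨hA1, hA2, hA3⟩
    · simp [writerMsg, hA2] at this
    · simp [writerMsg, hA2, hA3] at this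
      simp [Outbox.to, Msg.isWriter, Msg.isPreack, Msg.isAck, this, hpv]
      omega
  | writeIgnored t x hg =>
    by_cases hj : j = w
    · have := hm hj rfl
      rcases hA with ⟨hA1, hA2, hA3⟩ | ⟨hA1, hA2, hA3⟩
      · simp [writerMsg, hA2] at this
      · simp [writerMsg, hA2, hA3] at this
        exact (hg ⟨hj, this.1, this.2.trans hpv.symm⟩).elim
    · simp [Outbox.silent, *]
  | read r =>
    refine ⟨hts, hpts, hpv, hv, by simp [Msg.isWriter], ?_, ?_⟩ <;>
      (unfold Outbox.to; split_ifs <;> simp [Msg.isPreack, Msg.isAck])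
  | _ => simp [Outbox.silent, Outbox.toAll, Msg.isWriter, Msg.isPreack, Msg.isAck, *]

/-- The effect of a delivery on the counters of the receiver. -/
theorem Receive.counters {i j : P} {s s' : LocalState P X} {m : Msg X} {out : Outbox P X}
    {res : Option X} (h : Receive 𝓕 𝓠 w i j s m s' out res) (k : P) :
    s'.preacks k = s.preacks k + (if k = j ∧ m.isPreack = true then 1 else 0) ∧
      s'.acks k = s.acks k + (if k = j ∧ m.isAck = true then 1 else 0) := by
  cases h <;> simp [Msg.isPreack, Msg.isAck, Function.update_apply] <;> split_ifs <;> simp_all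

/-- The next message of the writer that a correct process receives is the expected one. -/
theorem ReplicaInv.head {val : ℕ → X} {i : P} (h : ReplicaInv val w i g) {m : Msg X}
    {rest : List (Msg X)} (hm : g.chan w i = m :: rest) (hmw : m.isWriter = true) :
    (g.proc i).pts + (g.proc i).ts < (g.proc w).sent ∧
      m = writerMsg val ((g.proc i).pts + (g.proc i).ts) ∧
      rest.filter Msg.isWriter =
        writerMsgs val ((g.proc i).pts + (g.proc i).ts + 1) (g.proc w).sent := by
  have h1 := h.pending
  rw [hm, List.filter_cons_of_pos hmw] at h1
  have hlt : (g.proc i).pts + (g.proc i).ts < (g.proc w).sent := by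
    refine lt_of_le_of_ne h.le_sent fun he => ?_
    rw [he, writerMsgs_self] at h1
    cases h1
  rw [writerMsgs_cons val hlt] at h1
  exact ⟨hlt, List.cons.inj h1⟩

theorem ReplicaInv.step {val : ℕ → X} {i : P} (h : Step 𝓕 𝓠 w F g l g') (hi : i ∉ F)
    (hw : w ∉ F) (hW : WriterInv val w g) (hg : ReplicaInv val w i g)
    (hval : ∀ x, l = .invokeWrite x → val ((g.proc w).wts + 1) = x) : ReplicaInv val w i g' := by
  have hg0 := hg
  obtain ⟨h1, h2, h3, h4, h5, h6, h7, h8⟩ := hg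
  cases h with
  | stutter => exact hg0
  | deliverFaulty b k m rest hk hm =>
    -- The invariant only speaks of the links between the correct processes `w` and `i`, which a
    -- delivery to a faulty process does not touch.
    have hik : i ≠ k := fun h => hi (h ▸ hk)
    have hwk : w ≠ k := fun h => hw (h ▸ hk)
    constructor <;> simp [GlobalState.setChan_proc, GlobalState.setChan_chan, *]
  | byzSend b k m hb =>
    have hib : i ≠ b := fun h => hi (h ▸ hb)
    have hwb : w ≠ b := fun h => hw (h ▸ hb)
    constructor <;> simp [GlobalState.setChan_proc, GlobalState.setChan_chan, *]
  | invokeWrite x _ hph =>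
    have hs : (g.proc w).sent = 2 * (g.proc w).wts := by simp [LocalState.sent, hph]
    have hmsg : writerMsg val (2 * (g.proc w).wts) = .prewrite ((g.proc w).wts + 1) x := by
      simp [writerMsg, hval x rfl]
    have hs' : ∀ s : LocalState P X, s.wts = (g.proc w).wts + 1 → s.phase = .prewriting x →
        s.sent = 2 * (g.proc w).wts + 1 := by
      intro s h h'
      simp [LocalState.sent, h, h']; omega
    rw [hs] at h1 h2
    have hc := writerMsgs_concat val h2
    by_cases hiw : i = w
    · subst hiw
      constructor <;>
        simp [GlobalState.act_proc, GlobalState.act_chan, Outbox.toAll, Msg.isWriter,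
          Msg.isPreack, Msg.isAck, *]
      omega
    · constructor <;>
        simp [GlobalState.act_proc, GlobalState.act_chan, Outbox.toAll, Msg.isWriter,
          Msg.isPreack, Msg.isAck, *]
      omega
  | prewriteDone x _ hph hq =>
    obtain ⟨hpos, hx⟩ := hW.prewriting x hph
    have hs : (g.proc w).sent = 2 * (g.proc w).wts - 1 := by simp [LocalState.sent, hph]
    -- Substituting `n + 1` removes the truncated subtraction in `sent`: the WRITE of timestamp `n +
    -- 1` is message number `2 * n + 1`, counting from zero.
    obtain ⟨n, hn⟩ : ∃ n, (g.proc w).wts = n + 1 := ⟨(g.proc w).wts - 1, by omega⟩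
    have hmsg : writerMsg val (2 * n + 1) = .write (n + 1) x := by
      have : (2 * n + 1) / 2 = n := by omega
      simp [writerMsg, hx, hn, this, Nat.add_mod]
    have hs' : ∀ s : LocalState P X, s.wts = (g.proc w).wts → s.phase = .writing x →
        s.sent = 2 * n + 1 + 1 := by
      intro s h h'
      simp [LocalState.sent, h, h']; omega
    have hs2 : (g.proc w).sent = 2 * n + 1 := by omega
    rw [hs2] at h1 h2
    have hc := writerMsgs_concat val h2
    clear hs hx
    by_cases hiw : i = w
    · subst hiw
      constructor <;>
        simp [GlobalState.act_proc, GlobalState.act_chan, Outbox.toAll, Msg.isWriter,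
          Msg.isPreack, Msg.isAck, *]
      omega
    · constructor <;>
        simp [GlobalState.act_proc, GlobalState.act_chan, Outbox.toAll, Msg.isWriter,
          Msg.isPreack, Msg.isAck, *]
      omega
  | writeDone _ hq =>
    obtain ⟨⟨x, hph⟩, -⟩ := hq
    have hs : (g.proc w).sent = 2 * (g.proc w).wts := by simp [LocalState.sent, hph]
    have hs' : ∀ s : LocalState P X, s.wts = (g.proc w).wts → s.phase = .idle →
        s.sent = 2 * (g.proc w).wts := by
      intro s h h'
      simp [LocalState.sent, h, h']
    rw [hs] at h1 h2
    by_cases hiw : i = w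
    · subst hiw
      constructor <;> simp [GlobalState.act_proc, GlobalState.act_chan, Outbox.silent, *]
    · constructor <;> simp [GlobalState.act_proc, GlobalState.act_chan, Outbox.silent, *]
  | invokeRead k _ hph =>
    have hs : ∀ s : LocalState P X, w = k → s.wts = (g.proc k).wts → s.phase = .reading →
        s.sent = (g.proc w).sent := by
      rintro s rfl h h'
      simp [LocalState.sent, h, h', hph]
    constructor <;> simp only [GlobalState.act_proc, GlobalState.act_chan, Outbox.toAll] <;>
      split_ifs <;> simp_all [Msg.isWriter, Msg.isPreack, Msg.isAck]
  | deliver b k m rest s' out res hk hm hr =>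
    have hsent : (((g.setChan b k rest).act k s' out).proc w).sent = (g.proc w).sent := by
      rw [GlobalState.act_proc, GlobalState.setChan_proc]
      split_ifs with hwk
      · subst hwk; exact hr.sent_eq.1
      · rfl
    have hfil : (((g.setChan b k rest).act k s' out).chan w i).filter Msg.isWriter =
        (if w = b ∧ i = k then rest else g.chan w i).filter Msg.isWriter := by
      rw [GlobalState.act_chan, GlobalState.setChan_chan]
      split_ifs <;> simp [List.filter_append, hr.filter_out]
    -- Balance on the link from `i` to `w`: a delivery on it removes `m`, a delivery to `i` appends
    -- the answer, and both happen at once if `i = w` receives from itself. The loss stands on the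
    -- left to avoid subtraction.
    have hcount : ∀ f : Msg X → Bool,
        (((g.setChan b k rest).act k s' out).chan i w).countP f +
          (if i = b ∧ w = k ∧ f m = true then 1 else 0) =
        (g.chan i w).countP f + (if i = k then (out w).countP f else 0) := by
      intro f
      rw [GlobalState.act_chan, GlobalState.setChan_chan]
      by_cases hbk : i = b ∧ w = k
      · have : g.chan i w = m :: rest := by rw [hbk.1, hbk.2, hm]
        rw [this, List.countP_cons]
        simp only [hbk]
        split_ifs <;> simp_all <;> omega
      · split_ifs <;> simp_all
    have hpre : ∀ j, (((g.setChan b k rest).act k s' out).proc w).preacks j =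
        (g.proc w).preacks j + (if j = b ∧ w = k ∧ m.isPreack = true then 1 else 0) := by
      intro j
      rw [GlobalState.act_proc, GlobalState.setChan_proc]
      split_ifs with hwk <;> simp_all [hr.counters]
    have hack : ∀ j, (((g.setChan b k rest).act k s' out).proc w).acks j =
        (g.proc w).acks j + (if j = b ∧ w = k ∧ m.isAck = true then 1 else 0) := by
      intro j
      rw [GlobalState.act_proc, GlobalState.setChan_proc]
      split_ifs with hwk <;> simp_all [hr.counters]
    have hc1 := hcount Msg.isPreack
    have hc2 := hcount Msg.isAck
    by_cases hik : i = k
    · subst hik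
      have hproc : ((g.setChan b i rest).act i s' out).proc i = s' := by
        simp [GlobalState.act_proc]
      have hhead : b = w → m.isWriter = true → _ := fun hb => hg0.head (hb ▸ hm)
      obtain ⟨e1, e2, e3, e4, e5, e6, e7⟩ := hr.replica_cases h3 h4 h5 h6
        fun hb hm' => (hhead hb hm').2.1
      simp only [if_true] at hc1 hc2
      refine ⟨?_, ?_, ?_, ?_, ?_, ?_, ?_, ?_⟩ <;> simp only [hproc, hsent, hfil, hpre, hack]
      · by_cases hb : b = w
        · subst hb
          simp only [and_self, if_true]
          rw [e5]
          by_cases hm' : m.isWriter = true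
          · simp [hm', (hhead rfl hm').2.2]
          · rw [hm, List.filter_cons_of_neg hm'] at h1
            simp [hm', h1]
        · rw [e5]
          simp [hb, Ne.symm hb, h1]
      · rw [e5]
        split_ifs with hb
        · exact (hhead hb.1 hb.2).1
        · exact h2
      · exact e1
      · exact e2
      · exact e3
      · exact e4
      · omega
      · omega
    · have hproc : ((g.setChan b k rest).act k s' out).proc i = g.proc i := by
        simp [GlobalState.act_proc, GlobalState.setChan_proc, hik]
      simp only [hik, if_false] at hc1 hc2
      refine ⟨?_, ?_, ?_, ?_, ?_, ?_, ?_, ?_⟩ <;> simp only [hproc, hsent, hfil, hpre, hack]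
      · simpa [hik] using h1
      · exact h2
      · exact h3
      · exact h4
      · exact h5
      · exact h6
      · omega
      · omega

/-! ### Monotonicity, and the course of an operation under one step -/

theorem Step.replica_mono (h : Step 𝓕 𝓠 w F g l g') {i : P}
    (hts : (g.proc i).ts ≤ (g.proc i).pts) :
    (g.proc i).pts ≤ (g'.proc i).pts ∧ (g.proc i).ts ≤ (g'.proc i).ts := by
  cases h with
  | stutter => simp
  | deliverFaulty => simp [GlobalState.setChan_proc]
  | byzSend => simp [GlobalState.setChan_proc]
  | deliver b k m rest s' out res hk hm hr =>
    rw [GlobalState.act_proc, GlobalState.setChan_proc]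
    split_ifs with hik
    · subst hik
      -- An accepted PREWRITE raises `pts` by one, and an accepted WRITE sets `ts` to `pts`; the
      -- latter does not decrease `ts` because `ts ≤ pts`.
      cases hr <;> simp
      · omega
      · omega
    · simp
  | _ =>
    rw [GlobalState.act_proc]
    split_ifs with hi
    · simp [hi]
    · simp

/-- Only `writeDone` can raise the number of completed writes, and its guard supplies the
acknowledging quorum. An invocation leaves the number unchanged, as it raises `wts` while making one
write pending. -/
theorem Step.completed_cases (h : Step 𝓕 𝓠 w F g l g') :
    (l = .writeDone ∧ AckQuorum 𝓠 w (g.proc w) ∧ (g'.proc w).wts = (g.proc w).wts ∧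
      (g'.proc w).completed = (g.proc w).wts) ∨
    (g'.proc w).completed = (g.proc w).completed := by
  cases h with
  | stutter => simp
  | deliverFaulty => simp [GlobalState.setChan_proc]
  | byzSend => simp [GlobalState.setChan_proc]
  | deliver b k m rest s' out res hk hm hr =>
    right
    rw [GlobalState.act_proc, GlobalState.setChan_proc]
    split_ifs with hik
    · subst hik
      exact hr.sent_eq.2.1
    · rfl
  | invokeWrite x hw hph => simp [GlobalState.act_proc, LocalState.completed, hph]
  | prewriteDone x hw hph hq => simp [GlobalState.act_proc, LocalState.completed, hph]
  | writeDone hw hq => simp [GlobalState.act_proc, LocalState.completed, hq]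
  | invokeRead k hk hph =>
    right
    rw [GlobalState.act_proc]
    split_ifs with hi
    · subst hi
      simp [LocalState.completed, hph]
    · rfl

theorem Step.wts_cases (h : Step 𝓕 𝓠 w F g l g') :
    (∃ x, l = .invokeWrite x ∧ (g.proc w).phase = .idle ∧ (g'.proc w).phase = .prewriting x ∧
      (g'.proc w).wts = (g.proc w).wts + 1) ∨
    ((∀ x, l ≠ .invokeWrite x) ∧ (g'.proc w).wts = (g.proc w).wts) := by
  cases h with
  | stutter => simp
  | deliverFaulty => simp [GlobalState.setChan_proc]
  | byzSend => simp [GlobalState.setChan_proc]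
  | deliver b k m rest s' out res hk hm hr =>
    right
    rw [GlobalState.act_proc, GlobalState.setChan_proc]
    split_ifs with hik
    · subst hik
      simp [hr.sent_eq.2.2]
    · simp
  | invokeWrite x hw hph => simp [GlobalState.act_proc, hph]
  | prewriteDone x hw hph hq => simp [GlobalState.act_proc]
  | writeDone hw hq => simp [GlobalState.act_proc]
  | invokeRead k hk hph =>
    right
    rw [GlobalState.act_proc]
    split_ifs with hi
    · subst hi
      simp
    · simp

/-- A write remains in its first phase until that phase ends. -/
theorem Step.prewriting_cases (h : Step 𝓕 𝓠 w F g l g') {x : X}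
    (hx : (g.proc w).phase = .prewriting x) :
    ((g'.proc w).wts = (g.proc w).wts ∧ ∀ e, l.event w ≠ some (w, e)) ∧
      ((l = .prewriteDone ∧ (g'.proc w).phase = .writing x) ∨
        (l ≠ .prewriteDone ∧ (g'.proc w).phase = .prewriting x)) := by
  cases h with
  | stutter => simp [Label.event, hx]
  | deliverFaulty => simp [GlobalState.setChan_proc, Label.event, hx]
  | byzSend => simp [GlobalState.setChan_proc, Label.event, hx]
  | deliver b k m rest s' out res hk hm hr =>
    rw [GlobalState.act_proc, GlobalState.setChan_proc]
    split_ifs with hik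
    · subst hik
      cases hr <;> simp_all [Label.event, AcceptsValue]
    · rcases res with _ | y <;> simp [Label.event, hx, Ne.symm hik]
  | invokeWrite y hw hph => simp [hx] at hph
  | prewriteDone y hw hph hq =>
    obtain rfl : x = y := by simpa [hx] using hph
    simp [GlobalState.act_proc, Label.event]
  | writeDone hw hq => simp [AckQuorum, hx] at hq
  | invokeRead k hk hph =>
    rw [GlobalState.act_proc]
    split_ifs with hi
    · subst hi
      simp [hx] at hph
    · simp [hx, Label.event, Ne.symm hi]

/-- A write remains in its second phase until it completes. -/
theorem Step.writing_cases (h : Step 𝓕 𝓠 w F g l g') {x : X}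
    (hx : (g.proc w).phase = .writing x) :
    l = .writeDone ∨ ((g'.proc w).phase = .writing x ∧
      (g'.proc w).wts = (g.proc w).wts ∧ ∀ e, l.event w ≠ some (w, e)) := by
  cases h with
  | stutter => simp [Label.event, hx]
  | deliverFaulty => simp [GlobalState.setChan_proc, Label.event, hx]
  | byzSend => simp [GlobalState.setChan_proc, Label.event, hx]
  | deliver b k m rest s' out res hk hm hr =>
    rw [GlobalState.act_proc, GlobalState.setChan_proc]
    split_ifs with hik
    · subst hik
      cases hr <;> simp_all [Label.event, AcceptsValue]
    · rcases res with _ | y <;> simp [Label.event, hx, Ne.symm hik]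
  | invokeWrite y hw hph => simp [hx] at hph
  | prewriteDone y hw hph hq => simp [hx] at hph
  | writeDone hw hq => simp
  | invokeRead k hk hph =>
    rw [GlobalState.act_proc]
    split_ifs with hi
    · subst hi
      simp [hx] at hph
    · simp [hx, Label.event, Ne.symm hi]

theorem Step.busy_cases (h : Step 𝓕 𝓠 w F g l g') (hb : (g.proc w).Busy) :
    l = .writeDone ∨ ((g'.proc w).Busy ∧
      (g'.proc w).wts = (g.proc w).wts ∧ ∀ e, l.event w ≠ some (w, e)) := by
  obtain ⟨x, hx⟩ | ⟨x, hx⟩ := hb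
  · obtain ⟨h1, ⟨-, h2⟩ | ⟨-, h2⟩⟩ := h.prewriting_cases hx
    · exact .inr ⟨.inr ⟨x, h2⟩, h1⟩
    · exact .inr ⟨.inl ⟨x, h2⟩, h1⟩
  · obtain h1 | ⟨h1, h2⟩ := h.writing_cases hx
    · exact .inl h1
    · exact .inr ⟨.inr ⟨x, h1⟩, h2⟩

theorem Step.not_busy_cases (h : Step 𝓕 𝓠 w F g l g') (hb : ¬ (g.proc w).Busy) :
    (∃ x, l = .invokeWrite x) ∨ ¬ (g'.proc w).Busy := by
  cases h with
  | stutter => exact .inr hb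
  | deliverFaulty => exact .inr hb
  | byzSend => exact .inr hb
  | deliver b k m rest s' out res hk hm hr =>
    right
    rw [GlobalState.act_proc, GlobalState.setChan_proc]
    split_ifs with hik
    · subst hik
      cases hr <;> simp_all [LocalState.Busy]
    · exact hb
  | invokeWrite y hw hph => simp
  | prewriteDone y hw hph hq => exact (hb (.inl ⟨y, hph⟩)).elim
  | writeDone hw hq => simp [GlobalState.act_proc, LocalState.Busy]
  | invokeRead k hk hph =>
    right
    rw [GlobalState.act_proc]
    split_ifs with hi
    · simp [LocalState.Busy]
    · exact hb

theorem Step.writeDone_inv (h : Step 𝓕 𝓠 w F g .writeDone g') :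
    ¬ (g'.proc w).Busy ∧ (g'.proc w).completed = (g.proc w).wts := by
  cases h with
  | writeDone hw hq => simp [GlobalState.act_proc, LocalState.Busy, LocalState.completed]

/-- A read remains pending until it returns. -/
theorem Step.reading_cases (h : Step 𝓕 𝓠 w F g l g') {p : P}
    (hp : (g.proc p).phase = .reading) :
    (∃ j x, l = .deliver j p (some x)) ∨ ((g'.proc p).phase = .reading ∧
      (g'.proc p).rid = (g.proc p).rid ∧ ∀ e, l.event w ≠ some (p, e)) := by
  cases h with
  | stutter => simp [Label.event, hp]
  | deliverFaulty => simp [GlobalState.setChan_proc, Label.event, hp]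
  | byzSend => simp [GlobalState.setChan_proc, Label.event, hp]
  | deliver b k m rest s' out res hk hm hr =>
    rw [GlobalState.act_proc, GlobalState.setChan_proc]
    split_ifs with hik
    · subst hik
      cases hr <;> simp_all [Label.event, AcceptsValue]
    · rcases res with _ | y <;> simp [Label.event, hp, Ne.symm hik]
  | invokeRead k hk hph =>
    rw [GlobalState.act_proc]
    split_ifs with hi
    · subst hi
      simp [hp] at hph
    · simp [hp, Label.event, Ne.symm hi]
  | invokeWrite y hw hph =>
    have : p ≠ w := by rintro rfl; simp [hp] at hph
    simp [GlobalState.act_proc, this, Label.event, hp, this.symm]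
  | prewriteDone y hw hph hq =>
    have : p ≠ w := by rintro rfl; simp [hp] at hph
    simp [GlobalState.act_proc, this, Label.event, hp]
  | writeDone hw hq =>
    have : p ≠ w := by rintro rfl; simp [AckQuorum, hp] at hq
    simp [GlobalState.act_proc, this, Label.event, hp, this.symm]

/-- Where the entries of a read list come from. -/
theorem Step.readlist_cases (h : Step 𝓕 𝓠 w F g l g') {p k : P} {e : Entry X}
    (he : (g'.proc p).readlist k = some e) :
    (g.proc p).readlist k = some e ∨
      Msg.value (g.proc p).rid e.pts e.pv e.ts e.v ∈ g.chan k p := by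
  cases h with
  | stutter => exact .inl he
  | deliverFaulty => exact .inl he
  | byzSend => exact .inl he
  | deliver b i m rest s' out res hi hm hr =>
    rw [GlobalState.act_proc, GlobalState.setChan_proc] at he
    split_ifs at he with hik
    · subst hik
      cases hr with
      | valueReturn r pts pv ts v t x hg hsel =>
        by_cases hk : k = b
        · subst hk
          simp at he
          subst he
          simp [hm, hg.2.1]
        · simp [hk] at he
          exact .inl he
      | valueRetry r pts pv ts v hg hsel =>
        by_cases hk : k = b
        · subst hk
          simp at he
          subst he
          simp [hm, hg.2.1]
        · simp [hk] at he
          exact .inl he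
      | _ => exact .inl he
    · exact .inl he
  | invokeRead i =>
    rw [GlobalState.act_proc] at he
    split_ifs at he
    exact .inl he
  | _ =>
    rw [GlobalState.act_proc] at he
    split_ifs at he with hi
    · subst hi
      exact .inl he
    · exact .inl he

theorem Step.sent_le (h : Step 𝓕 𝓠 w F g l g') : (g.proc w).sent ≤ (g'.proc w).sent := by
  cases h with
  | stutter => rfl
  | deliverFaulty => rfl
  | byzSend => rfl
  | deliver b k m rest s' out res hk hm hr =>
    rw [GlobalState.act_proc, GlobalState.setChan_proc]
    split_ifs with hik
    · subst hik
      exact hr.sent_eq.1.ge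
    · rfl
  | invokeWrite x hw hph =>
    simp [GlobalState.act_proc, LocalState.sent, hph]
    omega
  | prewriteDone x hw hph hq => simp [GlobalState.act_proc, LocalState.sent, hph]
  | writeDone hw hq =>
    obtain ⟨⟨x, hph⟩, -⟩ := hq
    simp [GlobalState.act_proc, LocalState.sent, hph]
  | invokeRead k hk hph =>
    rw [GlobalState.act_proc]
    split_ifs with hi
    · subst hi
      simp [LocalState.sent, hph]
    · rfl

theorem Step.invokeRead_inv {p : P} (h : Step 𝓕 𝓠 w F g (.invokeRead p) g') :
    (g'.proc p).phase = .reading ∧ (g'.proc p).rid = (g.proc p).rid + 1 ∧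
      (∀ k, (g'.proc p).readlist k = none) ∧ ∀ k, Msg.read (g'.proc p).rid ∈ g'.chan p k := by
  cases h with
  | invokeRead => simp [GlobalState.act_proc, GlobalState.act_chan, Outbox.toAll]

/-- Entries are overwritten but not erased during a read: the list is reset only by a new
invocation, which a pending read excludes. -/
theorem Step.readlist_isSome (h : Step 𝓕 𝓠 w F g l g') {p : P}
    (hp : (g.proc p).phase = .reading) {k : P} (hk : ((g.proc p).readlist k).isSome) :
    ((g'.proc p).readlist k).isSome := by
  cases h with
  | stutter => exact hk
  | deliverFaulty => exact hk
  | byzSend => exact hk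
  | deliver b i m rest s' out res hi hm hr =>
    rw [GlobalState.act_proc, GlobalState.setChan_proc]
    split_ifs with hik
    · subst hik
      cases hr <;> simp [Function.update_apply, hk]
      all_goals split_ifs <;> simp [hk]
    · exact hk
  | invokeRead i hi hph =>
    rw [GlobalState.act_proc]
    split_ifs with hip
    · subst hip
      simp [hp] at hph
    · exact hk
  | _ =>
    rw [GlobalState.act_proc]
    split_ifs with hi
    · subst hi
      exact hk
    · exact hk

/-- A correct process answers a request of a reader. -/
theorem Step.deliver_read {p k : P} {res : Option X} {r : ℕ} {rest : List (Msg X)}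
    (h : Step 𝓕 𝓠 w F g (.deliver p k res) g') (hk : k ∉ F)
    (hm : g.chan p k = .read r :: rest) :
    ∃ a b c d, Msg.value r a b c d ∈ g'.chan k p := by
  obtain ⟨m, rest', s', out, hm', hr, rfl⟩ := h.deliver_inv hk
  rw [hm] at hm'
  obtain ⟨rfl, rfl⟩ := List.cons.inj hm'
  cases hr
  refine ⟨(g.proc k).pts, (g.proc k).pv, (g.proc k).ts, (g.proc k).v, ?_⟩
  rw [GlobalState.act_chan, if_pos rfl]
  exact List.mem_append_right _ (by simp [Outbox.to])

/-- A reader that accepts a reply without returning repeats its request. -/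
theorem Step.deliver_value {p k : P} {r a c : ℕ} {b d : X} {rest : List (Msg X)}
    (h : Step 𝓕 𝓠 w F g (.deliver k p none) g') (hp : p ∉ F)
    (hm : g.chan k p = .value r a b c d :: rest)
    (hacc : AcceptsValue (g.proc p) r ⟨a, b, c, d⟩) :
    (∀ i, Msg.read (g.proc p).rid ∈ g'.chan p i) ∧
      (g'.proc p).readlist k = some ⟨a, b, c, d⟩ ∧
      ∀ t x, ¬ Selects 𝓕 𝓠 p (g'.proc p).readlist t x := by
  obtain ⟨m, rest', s', out, hm', hr, rfl⟩ := h.deliver_inv hp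
  rw [hm] at hm'
  obtain ⟨rfl, rfl⟩ := List.cons.inj hm'
  cases hr with
  | valueRetry _ _ _ _ _ hg hsel =>
    refine ⟨fun i => ?_, by simp [GlobalState.act_proc], by simpa [GlobalState.act_proc]⟩
    rw [GlobalState.act_chan, if_pos rfl]
    exact List.mem_append_right _ (by simp [Outbox.toAll])
  | valueIgnored _ _ _ _ _ hg => exact (hg hacc).elim

/-! ### Genuine replies and the invariant of the reader -/

/-- An entry reports a state that a correct process may have after `T` invocations of writes. -/
def Entry.Genuine (val : ℕ → X) (T : ℕ) (e : Entry X) : Prop :=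
  e.pv = val e.pts ∧ e.v = val e.ts ∧ e.ts ≤ e.pts ∧ e.pts ≤ e.ts + 1 ∧ e.pts ≤ T

theorem ReplicaInv.genuine {val : ℕ → X} {i : P} (h : ReplicaInv val w i g) :
    Entry.Genuine val (g.proc w).wts
      ⟨(g.proc i).pts, (g.proc i).pv, (g.proc i).ts, (g.proc i).v⟩ := by
  refine ⟨h.pv_eq, h.v_eq, h.ts_le, h.pts_le, ?_⟩
  -- The bound follows from `2 * pts ≤ pts + ts + 1 ≤ sent + 1 ≤ 2 * wts + 1`.
  have h1 := h.le_sent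
  have h2 := h.pts_le
  have h3 : (g.proc w).sent ≤ 2 * (g.proc w).wts := by
    unfold LocalState.sent; split <;> omega
  dsimp only
  omega

/-- What is invariant about a correct process `p` in its role as a reader and a correct
process `k` that answers it. -/
structure ReaderInv (val : ℕ → X) (w p k : P) (g : GlobalState P X) : Prop where
  value : ∀ r a b c d, Msg.value r a b c d ∈ g.chan k p →
    Entry.Genuine val (g.proc w).wts ⟨a, b, c, d⟩ ∧ r ≤ (g.proc p).rid
  read : ∀ r, Msg.read r ∈ g.chan p k → r ≤ (g.proc p).rid
  readlist : ∀ e, (g.proc p).readlist k = some e → Entry.Genuine val (g.proc w).wts e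

theorem Entry.Genuine.mono {val : ℕ → X} {T T' : ℕ} {e : Entry X} (h : e.Genuine val T)
    (hT : T ≤ T') : e.Genuine val T' :=
  ⟨h.1, h.2.1, h.2.2.1, h.2.2.2.1, h.2.2.2.2.trans hT⟩

theorem ChanStep.mem {j i : P} {q q' out : List (Msg X)} (h : ChanStep l j i q q' out)
    {m : Msg X} (hm : m ∈ q') : m ∈ q ∨ m ∈ out := by
  obtain ⟨res, m', -, rest, rfl, rfl⟩ | ⟨-, rfl⟩ := h
  · rcases List.mem_append.1 hm with h | h <;> simp [h]
  · exact List.mem_append.1 hm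

theorem ChanStep.mem_or_head {j i : P} {q q' out : List (Msg X)} (h : ChanStep l j i q q' out)
    {m : Msg X} (hm : m ∈ q) : m ∈ q' ∨ ∃ res rest, l = .deliver j i res ∧ q = m :: rest := by
  obtain ⟨res, m', hl, rest, rfl, rfl⟩ | ⟨-, rfl⟩ := h
  · rcases List.mem_cons.1 hm with rfl | h
    · exact .inr ⟨res, rest, hl, rfl⟩
    · exact .inl (List.mem_append_left _ h)
  · exact .inl (List.mem_append_left _ hm)

/-- A correct `k` sends a reply only in answer to a request in transit, with its own current state.
So genuineness comes from the replica invariant of `k`, and the bound on the identifier from that on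
the requests of `p`. -/
theorem ReaderInv.step {val : ℕ → X} {p k : P} (h : Step 𝓕 𝓠 w F g l g') (hp : p ∉ F)
    (hk : k ∉ F) (hR : ReplicaInv val w k g) (hg : ReaderInv val w p k g) :
    ReaderInv val w p k g' := by
  have hwts := (h.counters_le w).1
  have hrid := (h.counters_le p).2.1
  constructor
  · intro r a b c d hm
    obtain ⟨out, hout, ho⟩ := h.chan_cases k p
    rcases hout.mem hm with h' | h'
    · exact ⟨(hg.value _ _ _ _ _ h').1.mono hwts, (hg.value _ _ _ _ _ h').2.trans hrid⟩
    · obtain ⟨rfl, rfl, rfl, rfl, hr⟩ := (ho hk).1 _ _ _ _ _ h'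
      exact ⟨hR.genuine.mono hwts, (hg.read r hr).trans hrid⟩
  · intro r hm
    obtain ⟨out, hout, ho⟩ := h.chan_cases p k
    rcases hout.mem hm with h' | h'
    · exact (hg.read r h').trans hrid
    · exact ((ho hp).2 r h').le
  · intro e he
    rcases h.readlist_cases he with h' | h'
    · exact (hg.readlist e h').mono hwts
    · exact (hg.value _ _ _ _ _ h').1.mono hwts

end Step

/-! ### Timestamps and values of the writes in an execution -/

namespace Execution

variable {P X : Type*} [DecidableEq P] {𝓕 𝓠 : P → Set (Set P)} {w : P} {x₀ : X} {F : Set P}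
  (σ : Execution 𝓕 𝓠 w x₀ F)

/-- The number of writes invoked in the first `n` steps. -/
def wts (n : ℕ) : ℕ := ((σ.state n).proc w).wts

/-- `val t` is the value of the `t`-th write. -/
def IsVal (val : ℕ → X) : Prop :=
  val 0 = x₀ ∧ ∀ n x, σ.step n = .invokeWrite x → val (σ.wts n + 1) = x

theorem wts_mono : Monotone σ.wts :=
  monotone_nat_of_le_succ fun n => ((σ.next n).counters_le w).1

theorem wts_succ {n : ℕ} {x : X} (h : σ.step n = .invokeWrite x) :
    σ.wts (n + 1) = σ.wts n + 1 := by
  obtain ⟨y, -, -, -, h'⟩ | ⟨h', -⟩ := (σ.next n).wts_cases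
  · exact h'
  · exact (h' x h).elim

/-- An invocation at `b < a` would already have raised the counter by time `a`. Thus timestamps
order the writes by time of invocation and determine them. -/
theorem le_of_invokeWrite {a b : ℕ} {x : X} (hb : σ.step b = .invokeWrite x)
    (h : σ.wts a ≤ σ.wts b) : a ≤ b := by
  by_contra! hlt
  have := σ.wts_mono (show b + 1 ≤ a from hlt)
  rw [σ.wts_succ hb] at this
  omega

theorem completed_mono :
    Monotone fun n => ((σ.state n).proc w).completed := by
  refine monotone_nat_of_le_succ fun n => ?_
  obtain ⟨-, -, -, h⟩ | h := (σ.next n).completed_cases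
  · rw [h]
    unfold LocalState.completed; split <;> omega
  · exact h.ge

theorem exists_isVal : ∃ val, σ.IsVal val := by
  classical
  -- Timestamps that no write carries get the default `x₀`. This includes `0`, so the initial pair
  -- counts as genuine.
  refine ⟨fun t => if h : ∃ x n, σ.step n = .invokeWrite x ∧ σ.wts n + 1 = t then h.choose
    else x₀, ?_, ?_⟩
  · simp
  · intro n x hn
    have h : ∃ y m, σ.step m = .invokeWrite y ∧ σ.wts m + 1 = σ.wts n + 1 := ⟨x, n, hn, rfl⟩
    obtain ⟨m, hm, hmn⟩ := h.choose_spec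
    have h1 := σ.le_of_invokeWrite hm (a := n) (by omega)
    have h2 := σ.le_of_invokeWrite hn (a := m) (by omega)
    obtain rfl : m = n := le_antisymm h2 h1
    rw [hn] at hm
    exact (dif_pos h).trans (Label.invokeWrite.inj hm).symm

variable {σ} {val : ℕ → X}

theorem IsVal.writerInv (hv : σ.IsVal val) (n : ℕ) : WriterInv val w (σ.state n) := by
  induction n with
  | zero =>
    rw [σ.init]
    constructor <;> simp [GlobalState.init, LocalState.init]
  | succ n ih => exact ih.step (σ.next n) (hv.2 n)

theorem IsVal.replicaInv (hv : σ.IsVal val) (hw : w ∉ F) {i : P} (hi : i ∉ F) (n : ℕ) :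
    ReplicaInv val w i (σ.state n) := by
  induction n with
  | zero =>
    rw [σ.init]
    constructor <;>
      simp [GlobalState.init, LocalState.init, LocalState.sent, writerMsgs_self, hv.1]
  | succ n ih => exact ih.step (σ.next n) hi hw (hv.writerInv n) (hv.2 n)

theorem IsVal.readerInv (hv : σ.IsVal val) (hw : w ∉ F) {p k : P} (hp : p ∉ F) (hk : k ∉ F)
    (n : ℕ) : ReaderInv val w p k (σ.state n) := by
  induction n with
  | zero =>
    rw [σ.init]
    constructor <;> simp [GlobalState.init, LocalState.init]
  | succ n ih => exact ih.step (σ.next n) hp hk (hv.replicaInv hw hk n)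

theorem IsVal.pts_mono (hv : σ.IsVal val) (hw : w ∉ F) {i : P} (hi : i ∉ F) :
    Monotone fun n => ((σ.state n).proc i).pts :=
  monotone_nat_of_le_succ fun n => ((σ.next n).replica_mono (hv.replicaInv hw hi n).ts_le).1

theorem IsVal.ts_mono (hv : σ.IsVal val) (hw : w ∉ F) {i : P} (hi : i ∉ F) :
    Monotone fun n => ((σ.state n).proc i).ts :=
  monotone_nat_of_le_succ fun n => ((σ.next n).replica_mono (hv.replicaInv hw hi n).ts_le).2

/-- Every completed write has reached the correct processes of a quorum of the writer. -/
theorem IsVal.completed_quorum (hv : σ.IsVal val) (hw : w ∉ F) (hQ : (𝓠 w).Nonempty) (n : ℕ) :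
    ∃ Q ∈ 𝓠 w, ∀ j ∈ Q, j ∉ F →
      ((σ.state n).proc w).completed ≤ ((σ.state n).proc j).ts := by
  induction n with
  | zero =>
    obtain ⟨Q, hQ⟩ := hQ
    refine ⟨Q, hQ, fun j _ _ => ?_⟩
    rw [σ.init]
    simp [GlobalState.init, LocalState.init, LocalState.completed]
  | succ n ih =>
    -- A completing write offers its own acknowledging quorum: a correct process has sent exactly
    -- `ts` acknowledgements, so those counted bound `ts` from below. At any other step the previous
    -- quorum still serves, since `ts` never decreases.
    obtain ⟨-, ⟨-, Q, hQ, hack⟩, -, h⟩ | h := (σ.next n).completed_cases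
    · refine ⟨Q, hQ, fun j hj hjF => ?_⟩
      rw [h]
      have h1 := (hv.replicaInv hw hjF n).acks_add
      have h2 := hv.ts_mono hw hjF (Nat.le_add_right n 1)
      have h3 := hack j hj
      dsimp only at h2
      omega
    · obtain ⟨Q, hQ, hall⟩ := ih
      refine ⟨Q, hQ, fun j hj hjF => ?_⟩
      rw [h]
      exact (hall j hj hjF).trans (hv.ts_mono hw hjF (Nat.le_succ n))

/-- Every timestamp up to the current one is that of an invoked write. -/
theorem IsVal.exists_invokeWrite (hv : σ.IsVal val) {t n : ℕ} (h0 : 0 < t)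
    (h : t ≤ σ.wts n) : ∃ a < n, σ.step a = .invokeWrite (val t) ∧ σ.wts a + 1 = t := by
  induction n with
  | zero =>
    have : σ.wts 0 = 0 := by rw [wts, σ.init]; rfl
    omega
  | succ n ih =>
    by_cases hn : t ≤ σ.wts n
    · obtain ⟨a, ha, h'⟩ := ih hn
      exact ⟨a, by omega, h'⟩
    · obtain ⟨y, h1, -, -, h2⟩ | ⟨-, h2⟩ := (σ.next n).wts_cases
      · have ht : σ.wts n + 1 = t := by
          change σ.wts (n + 1) = σ.wts n + 1 at h2
          omega
        refine ⟨n, by omega, ?_, ht⟩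
        rw [h1, ← ht, hv.2 n y h1]
      · change σ.wts (n + 1) = σ.wts n at h2
        omega

/-! ### Pending operations and the history -/

variable (σ)

theorem busy_of_invokeWrite {n : ℕ} {x : X} (h : σ.step n = .invokeWrite x) :
    ((σ.state (n + 1)).proc w).Busy := by
  obtain ⟨y, -, -, h', -⟩ | ⟨h', -⟩ := (σ.next n).wts_cases
  · exact .inl ⟨y, h'⟩
  · exact (h' x h).elim

/-- A write that does not complete is still pending. -/
theorem busy_or_completes {n : ℕ} (h : ((σ.state n).proc w).Busy) {m : ℕ} (hm : n ≤ m) :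
    (((σ.state m).proc w).Busy ∧ σ.wts m = σ.wts n ∧
      ∀ k, n ≤ k → k < m → ∀ e, σ.history k ≠ some (w, e)) ∨
    ∃ b, n ≤ b ∧ b < m ∧ σ.step b = .writeDone ∧
      ∀ k, n ≤ k → k < b → ∀ e, σ.history k ≠ some (w, e) := by
  induction m, hm using Nat.le_induction with
  | base => exact .inl ⟨h, rfl, fun k h1 h2 => by omega⟩
  | succ m hm ih =>
    obtain ⟨h1, h2, h3⟩ | ⟨b, h1, h2, h3⟩ := ih
    · obtain h4 | ⟨h4, h5, h6⟩ := (σ.next m).busy_cases h1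
      · exact .inr ⟨m, hm, by omega, h4, h3⟩
      · refine .inl ⟨h4, Eq.trans h5 h2, fun k hk hk' => ?_⟩
        rcases Nat.lt_succ_iff_lt_or_eq.1 hk' with h7 | rfl
        · exact h3 k hk h7
        · exact h6
    · exact .inr ⟨b, h1, by omega, h3⟩

/-- A read that does not return is still pending. -/
theorem reading_or_returns {p : P} {n : ℕ} (h : ((σ.state n).proc p).phase = .reading) {m : ℕ}
    (hm : n ≤ m) :
    (((σ.state m).proc p).phase = .reading ∧
      ((σ.state m).proc p).rid = ((σ.state n).proc p).rid ∧
      ∀ k, n ≤ k → k < m → ∀ e, σ.history k ≠ some (p, e)) ∨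
    ∃ b, n ≤ b ∧ b < m ∧ (∃ j x, σ.step b = .deliver j p (some x)) ∧
      ∀ k, n ≤ k → k < b → ∀ e, σ.history k ≠ some (p, e) := by
  induction m, hm using Nat.le_induction with
  | base => exact .inl ⟨h, rfl, fun k h1 h2 => by omega⟩
  | succ m hm ih =>
    obtain ⟨h1, h2, h3⟩ | ⟨b, h1, h2, h3⟩ := ih
    · obtain h4 | ⟨h4, h5, h6⟩ := (σ.next m).reading_cases h1
      · exact .inr ⟨m, hm, by omega, h4, h3⟩
      · refine .inl ⟨h4, Eq.trans h5 h2, fun k hk hk' => ?_⟩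
        rcases Nat.lt_succ_iff_lt_or_eq.1 hk' with h7 | rfl
        · exact h3 k hk h7
        · exact h6
    · exact .inr ⟨b, h1, by omega, h3⟩

theorem history_eq_writeInv {n : ℕ} {q : P} {x : X} :
    σ.history n = some (q, .writeInv x) ↔ q = w ∧ σ.step n = .invokeWrite x := by
  unfold history
  rcases σ.step n with _ | _ | _ | _ | _ | ⟨j, i, _ | y⟩ | _ <;>
    simp [Label.event, eq_comm]

theorem history_eq_writeAck {n : ℕ} {q : P} :
    σ.history n = some (q, .writeAck) ↔ q = w ∧ σ.step n = .writeDone := by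
  unfold history
  rcases σ.step n with _ | _ | _ | _ | _ | ⟨j, i, _ | y⟩ | _ <;>
    simp [Label.event, eq_comm]

theorem history_eq_readInv {n : ℕ} {q : P} :
    σ.history n = some (q, .readInv) ↔ σ.step n = .invokeRead q := by
  unfold history
  rcases σ.step n with _ | _ | _ | _ | _ | ⟨j, i, _ | y⟩ | _ <;>
    simp [Label.event]

theorem history_eq_readRet {n : ℕ} {q : P} {x : X} :
    σ.history n = some (q, .readRet x) ↔ ∃ j, σ.step n = .deliver j q (some x) := by
  unfold history
  rcases σ.step n with _ | _ | _ | _ | _ | ⟨j, i, _ | y⟩ | _ <;>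
    simp [Label.event]

variable {σ}

/-- A write precedes a point in time iff its timestamp is among the completed ones. -/
theorem IsVal.writePrecedes_iff (hv : σ.IsVal val) {a n : ℕ} {x : X}
    (ha : σ.step a = .invokeWrite x) :
    σ.history.WritePrecedes a n ↔ σ.wts a + 1 ≤ ((σ.state n).proc w).completed := by
  constructor
  · rintro ⟨b, ⟨q, y, -, hab, hb, -⟩, hbn⟩
    obtain ⟨rfl, hb⟩ := σ.history_eq_writeAck.1 hb
    have h1 := σ.wts_mono (show a + 1 ≤ b from hab)
    rw [σ.wts_succ ha] at h1
    have h2 := σ.completed_mono (show b + 1 ≤ n from hbn)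
    dsimp only at h2
    have h3 : ((σ.state (b + 1)).proc q).completed = σ.wts b := by
      have := σ.next b
      rw [hb] at this
      exact this.writeDone_inv.2
    omega
  · intro h
    have hcw : ((σ.state n).proc w).completed ≤ σ.wts n := by
      unfold LocalState.completed wts; split <;> omega
    -- Up to time `a` the counter has not reached the timestamp `wts a + 1`, so that many writes
    -- cannot be completed.
    have han : a + 1 ≤ n := by
      by_contra! hlt
      have := σ.wts_mono (show n ≤ a by omega)
      omega
    obtain ⟨h1, h2, -⟩ | ⟨b, h1, h2, h3, h4⟩ :=
      σ.busy_or_completes (σ.busy_of_invokeWrite ha) han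
    -- If the write were still pending at time `n`, only `wts a` writes would be completed.
    · have : ((σ.state n).proc w).completed = σ.wts n - 1 := by
        obtain ⟨y, hy⟩ | ⟨y, hy⟩ := h1 <;> simp [LocalState.completed, wts, hy]
      rw [σ.wts_succ ha] at h2
      omega
    · exact ⟨b, ⟨w, x, σ.history_eq_writeInv.2 ⟨rfl, ha⟩, by omega,
        σ.history_eq_writeAck.2 ⟨rfl, h3⟩, fun k hk => h4 k hk⟩, h2⟩

/-! ### Safety -/

/-- The freshness of the replies to the read that is invoked at time `n`. -/
theorem IsVal.fresh_replies (hv : σ.IsVal val) (hw : w ∉ F) {p k : P} (hp : p ∉ F) (hk : k ∉ F)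
    {n m : ℕ} (hn : σ.step n = .invokeRead p) (hm : n + 1 ≤ m)
    (hrid : ∀ b, n + 1 ≤ b → b < m →
      ((σ.state b).proc p).rid = ((σ.state (n + 1)).proc p).rid) :
    (∀ a b c d, Msg.value ((σ.state (n + 1)).proc p).rid a b c d ∈ (σ.state m).chan k p →
      ((σ.state n).proc k).ts ≤ c) ∧
    ∀ e, ((σ.state m).proc p).readlist k = some e → ((σ.state n).proc k).ts ≤ e.ts := by
  have hnext := σ.next n
  rw [hn] at hnext
  obtain ⟨-, hrid_succ, hempty, -⟩ := hnext.invokeRead_inv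
  have hR := hv.readerInv hw hp hk n
  induction m, hm using Nat.le_induction with
  | base =>
    refine ⟨fun a b c d hmem => ?_, fun e he => ?_⟩
    · obtain ⟨out, hout, ho⟩ := hnext.chan_cases k p
      -- Right after the invocation no reply with the new identifier can exist: replies already in
      -- transit, and requests being answered in this very step, carry identifiers at most the old
      -- `rid`.
      rcases hout.mem hmem with h' | h'
      · have := (hR.value _ _ _ _ _ h').2
        omega
      · obtain ⟨-, -, -, -, hr⟩ := (ho hk).1 _ _ _ _ _ h'
        have := hR.read _ hr
        omega
    · rw [hempty] at he
      cases he
  | succ m hm ih =>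
    obtain ⟨ih1, ih2⟩ := ih fun b hb hb' => hrid b hb (by omega)
    refine ⟨fun a b c d hmem => ?_, fun e he => ?_⟩
    · obtain ⟨out, hout, ho⟩ := (σ.next m).chan_cases k p
      rcases hout.mem hmem with h' | h'
      · exact ih1 _ _ _ _ h'
      · obtain ⟨-, -, rfl, -, -⟩ := (ho hk).1 _ _ _ _ _ h'
        exact hv.ts_mono hw hk (show n ≤ m by omega)
    · rcases (σ.next m).readlist_cases he with h' | h'
      · exact ih2 e h'
      · rw [hrid m hm (by omega)] at h'
        exact ih1 _ _ _ _ h'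

/-- The timestamp `t` of the selected pair is squeezed between the number of writes completed at the
invocation (quorum condition) and the number of writes invoked by the return (core set condition).
-/
theorem IsVal.safety (hv : σ.IsVal val) (h𝓠 : IsAsymQuorumSystem 𝓕 𝓠) (hw : w ∈ wise 𝓕 F)
    {p : P} (hp : p ∈ wise 𝓕 F) {n m : ℕ} {x : X} (h : σ.history.ReadCompletes p n m x) :
    σ.history.LastWritten (wise 𝓕 F) x₀ n x ∨
      ∃ a, σ.history.IsWrite (wise 𝓕 F) a x ∧ σ.history.WriteConcurrent a n m := by
  obtain ⟨hn, hnm, hm, hbetween⟩ := h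
  rw [history_eq_readInv] at hn
  obtain ⟨j, hm⟩ := σ.history_eq_readRet.1 hm
  have hphase : ((σ.state (n + 1)).proc p).phase = .reading := by
    have := σ.next n
    rw [hn] at this
    exact this.invokeRead_inv.1
  have hrid : ∀ b, n + 1 ≤ b → b < m + 1 →
      ((σ.state b).proc p).rid = ((σ.state (n + 1)).proc p).rid := by
    intro b hb hbm
    obtain ⟨-, h, -⟩ | ⟨c, h1, h2, ⟨i, y, h3⟩, -⟩ := σ.reading_or_returns hphase hb
    · exact h
    · exact (hbetween c (by omega) (by omega) _ (σ.history_eq_readRet.2 ⟨i, h3⟩)).elim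
  obtain ⟨t, hcore, hquorum⟩ :
      ∃ t, Selects 𝓕 𝓠 p ((σ.state (m + 1)).proc p).readlist t x := by
    have := σ.next m
    rw [hm] at this
    obtain ⟨msg, rest, s', out, -, hr, hs⟩ := this.deliver_inv hp.1
    rw [hs]
    cases hr with
    | valueReturn r pts pv ts v t x hg hsel => exact ⟨t, by simpa [GlobalState.act_proc]⟩
  obtain ⟨A, hA, hFA⟩ := hp.2
  obtain ⟨B, hB, hFB⟩ := hw.2
  obtain ⟨QB, hQB, -⟩ := h𝓠.availability w B hB
  have hwts : σ.wts (m + 1) = σ.wts m := by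
    obtain ⟨y, h1, -⟩ | ⟨-, h1⟩ := (σ.next m).wts_cases
    · rw [hm] at h1; cases h1
    · exact h1
  -- the selected pair is genuine
  obtain ⟨hx, ht⟩ : x = val t ∧ t ≤ σ.wts m := by
    obtain ⟨C, hC, hCs⟩ := hcore
    -- The foreseen set `A` contains `F`, so a member of the core set outside `A` is correct and
    -- vouches for the pair.
    obtain ⟨k, hkC, hkA⟩ := Set.not_subset.1 (hC.1 A hA)
    have hkF : k ∉ F := fun h => hkA (hFA h)
    obtain ⟨e, he, hcar⟩ := hCs hkC
    obtain ⟨h1, h2, h3, -, h5⟩ := (hv.readerInv hw.1 hp.1 hkF (m + 1)).readlist e he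
    change e.pts ≤ σ.wts (m + 1) at h5
    rcases hcar with hc | hc <;> obtain ⟨rfl, rfl⟩ := Prod.mk.inj hc
    · exact ⟨h1, by omega⟩
    · exact ⟨h2, by omega⟩
  -- the selected pair is at least as recent as the last completed write
  have hle : ((σ.state n).proc w).completed ≤ t := by
    obtain ⟨Q, hQ, hQs⟩ := hquorum
    obtain ⟨Q', hQ', hQc⟩ := hv.completed_quorum hw.1 ⟨QB, hQB⟩ n
    -- Reader and writer are both wise, so `F` itself is admissible in the consistency condition,
    -- and the two quorums share a correct process.
    obtain ⟨k, hk, hkF⟩ := Set.not_subset.1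
      (h𝓠.consistency p w Q hQ Q' hQ' F ⟨⟨A, hA, hFA⟩, ⟨B, hB, hFB⟩⟩)
    obtain ⟨e, he, hsel⟩ := hQs hk.1
    have h1 := (hv.fresh_replies hw.1 hp.1 hkF hn (show n + 1 ≤ m + 1 by omega) hrid).2 e he
    have h2 := hQc k hk.2 hkF
    obtain ⟨-, -, h3, -, -⟩ := (hv.readerInv hw.1 hp.1 hkF (m + 1)).readlist e he
    rcases hsel with h | hc | hc
    · omega
    · obtain ⟨rfl, rfl⟩ := Prod.mk.inj hc
      omega
    · obtain ⟨rfl, rfl⟩ := Prod.mk.inj hc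
      omega
  -- Timestamp `0` belongs to no write: it stands for the initial value, and then no write has
  -- completed.
  rcases Nat.eq_zero_or_pos t with rfl | htpos
  · left; right
    refine ⟨hx.trans hv.1, ?_⟩
    rintro a y ⟨q, -, ha⟩ hpre
    obtain ⟨rfl, ha⟩ := σ.history_eq_writeInv.1 ha
    rw [hv.writePrecedes_iff ha] at hpre
    omega
  · obtain ⟨a, ham, ha, hat⟩ := hv.exists_invokeWrite htpos ht
    have hwrite : σ.history.IsWrite (wise 𝓕 F) a x :=
      ⟨w, hw, σ.history_eq_writeInv.2 ⟨rfl, hx ▸ ha⟩⟩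
    -- A timestamp above the completed ones belongs to a write invoked before the return but not
    -- completed before the read began; equality singles out the latest completed write.
    rcases hle.lt_or_eq with hlt | heq
    · right
      refine ⟨a, hwrite, ?_, by omega⟩
      rw [hv.writePrecedes_iff ha]
      omega
    · left; left
      refine ⟨a, hwrite, (hv.writePrecedes_iff ha).2 (by omega), ?_⟩
      rintro a' y ⟨q, -, ha'⟩ hpre
      obtain ⟨rfl, ha'⟩ := σ.history_eq_writeInv.1 ha'
      rw [hv.writePrecedes_iff ha'] at hpre
      exact σ.le_of_invokeWrite ha (by omega)

end Execution

/-- A finite set that lies in no fail-prone set can be shrunk to a minimal one with this property.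
-/
theorem exists_coreSet_subset {P : Type*} [Finite P] {𝓐 : Set (Set P)} {S : Set P}
    (hS : ∀ A ∈ 𝓐, ¬ S ⊆ A) : ∃ C ∈ coreSets 𝓐, C ⊆ S := by
  obtain ⟨C, hCS, hC⟩ :=
    exists_minimal_le_of_wellFoundedLT (fun C : Set P => ∀ A ∈ 𝓐, ¬ C ⊆ A) S hS
  refine ⟨C, ⟨hC.prop, fun C' hC' => ?_⟩, hCS⟩
  by_contra! h
  exact hC'.2 (hC.le_of_le h hC'.1)

/-- A wise process has a quorum of correct processes. -/
theorem IsAsymQuorumSystem.exists_correct_quorum {P : Type*} {𝓕 𝓠 : P → Set (Set P)}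
    {F : Set P} (h𝓠 : IsAsymQuorumSystem 𝓕 𝓠) {p : P} (hp : p ∈ wise 𝓕 F) : ∃ Q ∈ 𝓠 p, ∀ j ∈ Q, j ∉ F := by
  obtain ⟨A, hA, hFA⟩ := hp.2
  obtain ⟨Q, hQ, hAQ⟩ := h𝓠.availability p A hA
  exact ⟨Q, hQ, fun j hj hjF => (hAQ ▸ (⟨hFA hjF, hj⟩ : j ∈ A ∩ Q) : j ∈ (∅ : Set P))⟩

/-! ### Fairness and FIFO delivery -/

namespace Execution

open Filter

variable {P X : Type*} [DecidableEq P] {𝓕 𝓠 : P → Set (Set P)} {w : P} {x₀ : X} {F : Set P}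
  {σ : Execution 𝓕 𝓠 w x₀ F} {val : ℕ → X}

/-- A nonempty channel to a correct process eventually delivers its oldest message. -/
theorem Fair.next_delivery (hf : σ.Fair) {j i : P} (hi : i ∉ F) {n : ℕ}
    (hne : (σ.state n).chan j i ≠ []) {G : Msg X → Prop}
    (hG : ∀ m, n ≤ m → ∃ out, ChanStep (σ.step m) j i ((σ.state m).chan j i)
      ((σ.state (m + 1)).chan j i) out ∧ ∀ x ∈ out, G x) :
    ∃ m, n ≤ m ∧ ∃ res q, σ.step m = .deliver j i res ∧
      (σ.state m).chan j i = (σ.state n).chan j i ++ q ∧ ∀ x ∈ q, G x := by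
  -- Without a delivery the queue only grows at its end, by messages satisfying `G`. It then stays
  -- nonempty forever, so fairness forces a delivery after all.
  by_contra! hcon
  have key : ∀ m, n ≤ m → ∃ q, (σ.state m).chan j i = (σ.state n).chan j i ++ q ∧
      ∀ x ∈ q, G x := by
    intro m hm
    induction m, hm using Nat.le_induction with
    | base => exact ⟨[], by simp⟩
    | succ m hm ih =>
      obtain ⟨q, hq, hqG⟩ := ih
      obtain ⟨out, ⟨res, a, hl, -⟩ | ⟨-, h⟩, hout⟩ := hG m hm
      · obtain ⟨x, hx, hxG⟩ := hcon m hm res q hl hq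
        exact (hxG (hqG x hx)).elim
      · refine ⟨q ++ out, by rw [h, hq, List.append_assoc], fun x hx => ?_⟩
        rcases List.mem_append.1 hx with h | h
        · exact hqG x h
        · exact hout x h
  obtain ⟨m, hm, res, hl⟩ := hf.delivery j i hi n fun m hm h => by
    obtain ⟨q, hq, -⟩ := key m hm
    rw [hq] at h
    exact hne (List.append_eq_nil_iff.1 h).1
  obtain ⟨q, hq, hqG⟩ := key m hm
  obtain ⟨x, hx, hxG⟩ := hcon m hm res q hl hq
  exact hxG (hqG x hx)

/-- Links are FIFO: a prefix of a channel is eventually delivered, and only messages sent later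
follow the rest. -/
theorem Fair.deliver_prefix (hf : σ.Fair) {j i : P} (hi : i ∉ F) {G : Msg X → Prop}
    (q₁ q₂ : List (Msg X)) {n : ℕ} (hq : ∃ q, (σ.state n).chan j i = q₁ ++ (q₂ ++ q) ∧
      ∀ x ∈ q, G x)
    (hG : ∀ m, n ≤ m → ∃ out, ChanStep (σ.step m) j i ((σ.state m).chan j i)
      ((σ.state (m + 1)).chan j i) out ∧ ∀ x ∈ out, G x) :
    ∃ m, n ≤ m ∧ ∃ q, (σ.state m).chan j i = q₂ ++ q ∧ ∀ x ∈ q, G x := by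
  induction q₁ generalizing n with
  | nil => exact ⟨n, le_rfl, hq⟩
  | cons a q₁ ih =>
    obtain ⟨q, hq, hqG⟩ := hq
    obtain ⟨m, hm, res, q', hl, hq', hqG'⟩ := hf.next_delivery hi (by simp [hq]) hG
    obtain ⟨out, ⟨res, b, -, rest, h1, h2⟩ | ⟨h, -⟩, hout⟩ := hG m hm
    · obtain ⟨m', hm', h⟩ := ih (n := m + 1) ⟨q ++ q' ++ out, by
          rw [hq', hq] at h1
          simp only [List.cons_append, List.cons.injEq] at h1
          rw [h2, ← h1.2]
          simp, by
          intro x hx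
          simp only [List.mem_append] at hx
          rcases hx with (hx | hx) | hx
          · exact hqG x hx
          · exact hqG' x hx
          · exact hout x hx⟩ fun k hk => hG k (by omega)
      exact ⟨m', by omega, h⟩
    · exact (h res hl).elim

theorem exists_chanStep (σ : Execution 𝓕 𝓠 w x₀ F) (j i : P) (m : ℕ) :
    ∃ out, ChanStep (σ.step m) j i ((σ.state m).chan j i) ((σ.state (m + 1)).chan j i) out ∧
      ∀ x ∈ out, True := by
  obtain ⟨out, h, -⟩ := (σ.next m).chan_cases j i
  exact ⟨out, h, fun _ _ => trivial⟩

/-- Every message in transit to a correct process is eventually delivered. -/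
theorem Fair.eventually_delivered (hf : σ.Fair) {j i : P} (hi : i ∉ F) {n : ℕ} {a : Msg X}
    (ha : a ∈ (σ.state n).chan j i) :
    ∃ m, n ≤ m ∧ ∃ res rest, σ.step m = .deliver j i res ∧
      (σ.state m).chan j i = a :: rest := by
  obtain ⟨q₁, q₂, hq⟩ := List.append_of_mem ha
  -- First everything ahead of `a` is flushed, which brings `a` to the head; the next delivery on
  -- the link is then that of `a`.
  obtain ⟨m, hm, q, hmq, -⟩ := hf.deliver_prefix hi q₁ (a :: q₂) ⟨[], by simpa using hq, by simp⟩
    fun m _ => σ.exists_chanStep j i m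
  obtain ⟨m', hm', res, q', hl, hq', -⟩ := hf.next_delivery hi (n := m) (by simp [hmq])
    fun m _ => σ.exists_chanStep j i m
  exact ⟨m', by omega, res, _, hl, by rw [hq', hmq]; rfl⟩

/-! ### Catching up with the writer, and liveness of writes -/

theorem sent_mono (σ : Execution 𝓕 𝓠 w x₀ F) :
    Monotone fun n => ((σ.state n).proc w).sent :=
  monotone_nat_of_le_succ fun n => (σ.next n).sent_le

theorem preacks_mono (σ : Execution 𝓕 𝓠 w x₀ F) (j : P) :
    Monotone fun n => ((σ.state n).proc w).preacks j :=
  monotone_nat_of_le_succ fun n => ((σ.next n).counters_le w).2.2.1 j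

theorem acks_mono (σ : Execution 𝓕 𝓠 w x₀ F) (j : P) :
    Monotone fun n => ((σ.state n).proc w).acks j :=
  monotone_nat_of_le_succ fun n => ((σ.next n).counters_le w).2.2.2 j

/-- Correct processes catch up with the writer. -/
theorem Fair.catch_up (hf : σ.Fair) (hv : σ.IsVal val) (hw : w ∉ F) {i : P} (hi : i ∉ F) {n : ℕ}
    (K : ℕ) (hK : K ≤ ((σ.state n).proc w).sent) :
    ∃ m, n ≤ m ∧ K ≤ ((σ.state m).proc i).pts + ((σ.state m).proc i).ts := by
  induction K with
  | zero => exact ⟨n, le_rfl, Nat.zero_le _⟩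
  | succ K ih =>
    obtain ⟨m, hm, hKm⟩ := ih (by omega)
    have hsent := σ.sent_mono hm
    dsimp only at hsent
    rcases hKm.lt_or_eq with hlt | heq
    · exact ⟨m, hm, hlt⟩
    -- Message number `K` has been sent but not processed, hence is in transit. When it is
    -- delivered, the receiver accepts it and `pts + ts` grows by one.
    · have hpend := (hv.replicaInv hw hi m).pending
      rw [writerMsgs_cons val (by omega)] at hpend
      have hmem : writerMsg val (((σ.state m).proc i).pts + ((σ.state m).proc i).ts) ∈
          (σ.state m).chan w i :=
        List.mem_of_mem_filter (p := Msg.isWriter) (by rw [hpend]; exact List.mem_cons_self)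
      obtain ⟨m', hm', res, rest, hl, hchan⟩ := hf.eventually_delivered hi hmem
      have hstep := σ.next m'
      rw [hl] at hstep
      obtain ⟨a, rest', s', out, hchan', hr, hs'⟩ := hstep.deliver_inv hi
      rw [hchan] at hchan'
      obtain ⟨rfl, rfl⟩ := List.cons.inj hchan'
      have hR := hv.replicaInv hw hi m'
      have hinc := (hr.replica_cases hR.ts_le hR.pts_le hR.pv_eq hR.v_eq
        fun _ h => (hR.head hchan h).2.1).2.2.2.2.1
      have h1 := hv.pts_mono hw hi hm'
      have h2 := hv.ts_mono hw hi hm'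
      simp only [writerMsg_isWriter, and_self, if_true] at hinc
      refine ⟨m' + 1, by omega, ?_⟩
      rw [hs', GlobalState.act_proc, if_pos rfl]
      dsimp only at h1 h2
      omega

/-- By `preacks_add`, answers that are not yet counted are in transit to the correct writer; each
delivery raises the count by one. -/
theorem Fair.preacks_catch_up (hf : σ.Fair) (hv : σ.IsVal val) (hw : w ∉ F) {j : P} (hj : j ∉ F)
    {n : ℕ} (K : ℕ) (hK : K ≤ ((σ.state n).proc j).pts) :
    ∃ m, n ≤ m ∧ K ≤ ((σ.state m).proc w).preacks j := by
  induction K with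
  | zero => exact ⟨n, le_rfl, Nat.zero_le _⟩
  | succ K ih =>
    obtain ⟨m, hm, hKm⟩ := ih (by omega)
    have hpts := hv.pts_mono hw hj hm
    dsimp only at hpts
    rcases hKm.lt_or_eq with hlt | heq
    · exact ⟨m, hm, hlt⟩
    · have hcount := (hv.replicaInv hw hj m).preacks_add
      obtain ⟨a, ha, hapre⟩ := List.countP_pos_iff.1
        (show 0 < ((σ.state m).chan j w).countP Msg.isPreack by omega)
      obtain ⟨m', hm', res, rest, hl, hchan⟩ := hf.eventually_delivered hw ha
      have hstep := σ.next m'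
      rw [hl] at hstep
      obtain ⟨b, rest', s', out, hchan', hr, hs'⟩ := hstep.deliver_inv hw
      rw [hchan] at hchan'
      obtain ⟨rfl, rfl⟩ := List.cons.inj hchan'
      have hinc := (hr.counters j).1
      have h1 := σ.preacks_mono j hm'
      simp only [hapre, and_self, if_true] at hinc
      refine ⟨m' + 1, by omega, ?_⟩
      rw [hs', GlobalState.act_proc, if_pos rfl]
      dsimp only at h1
      omega

theorem Fair.acks_catch_up (hf : σ.Fair) (hv : σ.IsVal val) (hw : w ∉ F) {j : P} (hj : j ∉ F)
    {n : ℕ} (K : ℕ) (hK : K ≤ ((σ.state n).proc j).ts) :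
    ∃ m, n ≤ m ∧ K ≤ ((σ.state m).proc w).acks j := by
  induction K with
  | zero => exact ⟨n, le_rfl, Nat.zero_le _⟩
  | succ K ih =>
    obtain ⟨m, hm, hKm⟩ := ih (by omega)
    have hts := hv.ts_mono hw hj hm
    dsimp only at hts
    rcases hKm.lt_or_eq with hlt | heq
    · exact ⟨m, hm, hlt⟩
    · have hcount := (hv.replicaInv hw hj m).acks_add
      obtain ⟨a, ha, hapre⟩ := List.countP_pos_iff.1
        (show 0 < ((σ.state m).chan j w).countP Msg.isAck by omega)
      obtain ⟨m', hm', res, rest, hl, hchan⟩ := hf.eventually_delivered hw ha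
      have hstep := σ.next m'
      rw [hl] at hstep
      obtain ⟨b, rest', s', out, hchan', hr, hs'⟩ := hstep.deliver_inv hw
      rw [hchan] at hchan'
      obtain ⟨rfl, rfl⟩ := List.cons.inj hchan'
      have hinc := (hr.counters j).2
      have h1 := σ.acks_mono j hm'
      simp only [hapre, and_self, if_true] at hinc
      refine ⟨m' + 1, by omega, ?_⟩
      rw [hs', GlobalState.act_proc, if_pos rfl]
      dsimp only at h1
      omega

/-- After `2 * K - 1` messages of the stream, `ts ≤ pts` forces `K ≤ pts`. For `ack` messages, `2 *
K` stream messages and `pts ≤ ts + 1` force `K ≤ ts`. -/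
theorem Fair.eventually_preacks (hf : σ.Fair) (hv : σ.IsVal val) (hw : w ∉ F) {j : P}
    (hj : j ∉ F) {n K : ℕ} (hK : 2 * K - 1 ≤ ((σ.state n).proc w).sent) :
    ∀ᶠ m in atTop, K ≤ ((σ.state m).proc w).preacks j := by
  obtain ⟨m, hm, h⟩ := hf.catch_up hv hw hj _ hK
  have := (hv.replicaInv hw hj m).ts_le
  obtain ⟨m', hm', h'⟩ := hf.preacks_catch_up hv hw hj (n := m) K (by omega)
  exact eventually_atTop.2 ⟨m', fun b hb => h'.trans (σ.preacks_mono j hb)⟩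

theorem Fair.eventually_acks (hf : σ.Fair) (hv : σ.IsVal val) (hw : w ∉ F) {j : P}
    (hj : j ∉ F) {n K : ℕ} (hK : 2 * K ≤ ((σ.state n).proc w).sent) :
    ∀ᶠ m in atTop, K ≤ ((σ.state m).proc w).acks j := by
  obtain ⟨m, hm, h⟩ := hf.catch_up hv hw hj _ hK
  have := (hv.replicaInv hw hj m).pts_le
  obtain ⟨m', hm', h'⟩ := hf.acks_catch_up hv hw hj (n := m) K (by omega)
  exact eventually_atTop.2 ⟨m', fun b hb => h'.trans (σ.acks_mono j hb)⟩

/-- A pending write of a wise writer completes. -/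
theorem Fair.exists_writeDone [Finite P] (hf : σ.Fair) (hv : σ.IsVal val)
    (h𝓠 : IsAsymQuorumSystem 𝓕 𝓠) (hw : w ∈ wise 𝓕 F) {n : ℕ}
    (hn : ((σ.state n).proc w).Busy) : ∃ m, n ≤ m ∧ σ.step m = .writeDone := by
  by_contra! hcon
  obtain ⟨Q, hQ, hQF⟩ := h𝓠.exists_correct_quorum hw
  have hbusy : ∀ m, n ≤ m → ((σ.state m).proc w).Busy ∧ σ.wts m = σ.wts n := by
    intro m hm
    obtain ⟨h1, h2, -⟩ | ⟨b, h1, -, h2, -⟩ := σ.busy_or_completes hn hm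
    · exact ⟨h1, h2⟩
    · exact (hcon b h1 h2).elim
  obtain ⟨m, hnm, x, hx⟩ : ∃ m, n ≤ m ∧ ∃ x, ((σ.state m).proc w).phase = .writing x := by
    by_contra! hcon'
    have hpre : ∀ m, n ≤ m → ∃ x, ((σ.state m).proc w).phase = .prewriting x := fun m hm =>
      (hbusy m hm).1.resolve_right fun ⟨x, hx⟩ => hcon' m hm x hx
    have hsent : 2 * σ.wts n - 1 ≤ ((σ.state n).proc w).sent := by
      obtain ⟨x, hx⟩ := hpre n le_rfl
      simp [LocalState.sent, hx, wts]
    have hev : ∀ᶠ m in atTop, ∀ j, j ∈ Q → σ.wts n ≤ ((σ.state m).proc w).preacks j := by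
      refine eventually_all.2 fun j => ?_
      by_cases hj : j ∈ Q
      · simpa [hj] using hf.eventually_preacks hv hw.1 (hQF j hj) hsent
      · simp [hj]
    obtain ⟨N, hN⟩ := eventually_atTop.1 hev
    -- Fairness needs the quorum condition to hold permanently. It does: the answer counters never
    -- decrease, and `wts` is frozen while the write is pending.
    obtain ⟨m, hm, hl⟩ := hf.prewriteDone hw.1 (max n N) fun m hm =>
      ⟨hpre m (le_of_max_le_left hm), Q, hQ, fun j hj =>
        (hbusy m (le_of_max_le_left hm)).2.le.trans (hN m (le_of_max_le_right hm) j hj)⟩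
    have hnm := le_of_max_le_left hm
    obtain ⟨x, hx⟩ := hpre m hnm
    obtain ⟨-, ⟨-, h⟩ | ⟨h, -⟩⟩ := (σ.next m).prewriting_cases hx
    · exact hcon' (m + 1) (by omega) x h
    · exact h hl
  have hwriting : ∀ b, m ≤ b → ((σ.state b).proc w).phase = .writing x := by
    intro b hb
    induction b, hb using Nat.le_induction with
    | base => exact hx
    | succ b hb ih =>
      obtain h | ⟨h, -⟩ := (σ.next b).writing_cases ih
      · exact (hcon b (by omega) h).elim
      · exact h
  have hsent : 2 * σ.wts n ≤ ((σ.state m).proc w).sent := by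
    have := (hbusy m hnm).2
    simp only [wts] at this ⊢
    simp [LocalState.sent, hx, this]
  have hev : ∀ᶠ m in atTop, ∀ j, j ∈ Q → σ.wts n ≤ ((σ.state m).proc w).acks j := by
    refine eventually_all.2 fun j => ?_
    by_cases hj : j ∈ Q
    · simpa [hj] using hf.eventually_acks hv hw.1 (hQF j hj) hsent
    · simp [hj]
  obtain ⟨N, hN⟩ := eventually_atTop.1 hev
  obtain ⟨b, hb, hl⟩ := hf.writeDone hw.1 (max m N) fun b hb =>
    ⟨⟨x, hwriting b (le_of_max_le_left hb)⟩, Q, hQ, fun j hj =>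
      (hbusy b (hnm.trans (le_of_max_le_left hb))).2.le.trans (hN b (le_of_max_le_right hb) j hj)⟩
  exact hcon b (hnm.trans (le_of_max_le_left hb)) hl

theorem Fair.write_liveness [Finite P] (hf : σ.Fair) (hv : σ.IsVal val)
    (h𝓠 : IsAsymQuorumSystem 𝓕 𝓠) (hw : w ∈ wise 𝓕 F) {p : P} {n : ℕ} {x : X}
    (h : σ.history n = some (p, .writeInv x)) : ∃ m, σ.history.NextEvent p n m .writeAck := by
  obtain ⟨rfl, hl⟩ := σ.history_eq_writeInv.1 h
  have hb := σ.busy_of_invokeWrite hl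
  obtain ⟨m, hm, hm'⟩ := hf.exists_writeDone hv h𝓠 hw hb
  -- The completion found at `m` need not be the first; the first one after the invocation is the
  -- response.
  obtain ⟨-, -, h3⟩ | ⟨b, h1, -, h2, h3⟩ := σ.busy_or_completes hb (show n + 1 ≤ m + 1 by omega)
  · exact (h3 m hm (by omega) _ (σ.history_eq_writeAck.2 ⟨rfl, hm'⟩)).elim
  · exact ⟨b, by omega, σ.history_eq_writeAck.2 ⟨rfl, h2⟩, fun k hk => h3 k hk⟩

/-! ### Stabilisation, and liveness of reads -/

/-- If there are finitely many writes, then all correct processes eventually store the last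
written pair. -/
theorem Fair.eventually_stable [Finite P] (hf : σ.Fair) (hv : σ.IsVal val)
    (h𝓠 : IsAsymQuorumSystem 𝓕 𝓠) (hw : w ∈ wise 𝓕 F) (hfin : σ.history.FinitelyManyWrites) :
    ∃ T, ∀ᶠ m in atTop, ∀ i, i ∉ F →
      ((σ.state m).proc i).pts = T ∧ ((σ.state m).proc i).ts = T := by
  obtain ⟨N, hN⟩ : ∃ N, ∀ m, N ≤ m → ∀ x, σ.step m ≠ .invokeWrite x := by
    obtain ⟨N, hN⟩ := hfin.bddAbove
    refine ⟨N + 1, fun m hm x hx => ?_⟩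
    have := hN ⟨w, x, σ.history_eq_writeInv.2 ⟨rfl, hx⟩⟩
    omega
  obtain ⟨N₁, hN₁, hidle⟩ : ∃ m, N ≤ m ∧ ¬ ((σ.state m).proc w).Busy := by
    by_cases hb : ((σ.state N).proc w).Busy
    · obtain ⟨m, hm, hl⟩ := hf.exists_writeDone hv h𝓠 hw hb
      have := σ.next m
      rw [hl] at this
      exact ⟨m + 1, by omega, this.writeDone_inv.1⟩
    · exact ⟨N, le_rfl, hb⟩
  have hstay : ∀ m, N₁ ≤ m → ¬ ((σ.state m).proc w).Busy ∧ σ.wts m = σ.wts N₁ := by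
    intro m hm
    induction m, hm using Nat.le_induction with
    | base => exact ⟨hidle, rfl⟩
    | succ m hm ih =>
      refine ⟨((σ.next m).not_busy_cases ih.1).resolve_left fun ⟨x, hx⟩ =>
        hN m (by omega) x hx, ?_⟩
      obtain ⟨x, hx, -⟩ | ⟨-, h⟩ := (σ.next m).wts_cases
      · exact (hN m (by omega) x hx).elim
      · exact Eq.trans h ih.2
  have hsent : ∀ m, N₁ ≤ m → ((σ.state m).proc w).sent = 2 * σ.wts N₁ := by
    intro m hm
    obtain ⟨h1, h2⟩ := hstay m hm
    rw [← h2]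
    unfold LocalState.sent
    split
    · rename_i x hx
      exact (h1 (.inl ⟨x, hx⟩)).elim
    · rfl
  refine ⟨σ.wts N₁, eventually_all.2 fun i => ?_⟩
  by_cases hi : i ∈ F
  · simp [hi]
  obtain ⟨m, hm, h⟩ := hf.catch_up hv hw.1 hi _ (hsent N₁ le_rfl).ge
  refine eventually_atTop.2 ⟨m, fun b hb _ => ?_⟩
  have h1 := hv.pts_mono hw.1 hi hb
  have h2 := hv.ts_mono hw.1 hi hb
  dsimp only at h1 h2
  -- Now `pts + ts` equals `2 * wts`, and `ts ≤ pts ≤ ts + 1` leaves only `pts = ts = wts` by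
  -- parity.
  have hR := hv.replicaInv hw.1 hi b
  have h3 := hR.ts_le
  have h4 := hR.pts_le
  have h5 := hR.le_sent
  rw [hsent b (hm.trans hb)] at h5
  omega

/-- From time `n` on, the read number `R` of the process `p` is pending. -/
def ReadingFrom (σ : Execution 𝓕 𝓠 w x₀ F) (p : P) (R n : ℕ) : Prop :=
  ∀ m, n ≤ m → ((σ.state m).proc p).phase = .reading ∧ ((σ.state m).proc p).rid = R ∧
    ∀ j x, σ.step m ≠ .deliver j p (some x)

theorem ReadingFrom.deliver_none {p : P} {R n : ℕ} (h : σ.ReadingFrom p R n) {m : ℕ}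
    (hm : n ≤ m) {j : P} {res : Option X} (hl : σ.step m = .deliver j p res) :
    Step 𝓕 𝓠 w F (σ.state m) (.deliver j p none) (σ.state (m + 1)) := by
  have := σ.next m
  rcases res with _ | x
  · rwa [hl] at this
  · exact ((h m hm).2.2 j x hl).elim

/-- The reply of a correct process to the pending read is accepted. -/
theorem ReadingFrom.accepts {p : P} {R n : ℕ} (h : σ.ReadingFrom p R n) (hv : σ.IsVal val)
    (hw : w ∉ F) (hp : p ∉ F) {k : P} (hk : k ∉ F) {m : ℕ} (hm : n ≤ m) {a c : ℕ} {b d : X}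
    (hmem : Msg.value R a b c d ∈ (σ.state m).chan k p) :
    AcceptsValue ((σ.state m).proc p) R ⟨a, b, c, d⟩ := by
  obtain ⟨⟨h1, h2, h3, h4, -⟩, -⟩ := (hv.readerInv hw hp hk m).value _ _ _ _ _ hmem
  refine ⟨(h m hm).1, (h m hm).2.1.symm, ?_⟩
  dsimp only at h1 h2 h3 h4 ⊢
  rcases h3.lt_or_eq with hlt | rfl
  · left; omega
  · right; rw [h1, h2]

/-- While a read is pending, a request to or a reply from each correct process is in transit. -/
theorem ReadingFrom.in_transit {p : P} {R n : ℕ} (h : σ.ReadingFrom p R n) (hv : σ.IsVal val)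
    (hw : w ∉ F) (hp : p ∉ F) {k : P} (hk : k ∉ F)
    (hn : Msg.read R ∈ (σ.state n).chan p k) {m : ℕ} (hm : n ≤ m) :
    Msg.read R ∈ (σ.state m).chan p k ∨
      ∃ a b c d, Msg.value R a b c d ∈ (σ.state m).chan k p := by
  induction m, hm using Nat.le_induction with
  | base => exact .inl hn
  | succ m hm ih =>
    rcases ih with hmem | ⟨a, b, c, d, hmem⟩
    · obtain ⟨out, hout, -⟩ := (σ.next m).chan_cases p k
      rcases hout.mem_or_head hmem with h' | ⟨res, rest, hl, hchan⟩
      · exact .inl h'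
      · have := σ.next m
        rw [hl] at this
        exact .inr (this.deliver_read hk hchan)
    · obtain ⟨out, hout, -⟩ := (σ.next m).chan_cases k p
      rcases hout.mem_or_head hmem with h' | ⟨res, rest, hl, hchan⟩
      · exact .inr ⟨a, b, c, d, h'⟩
      · left
        have := ((h.deliver_none hm hl).deliver_value hp hchan
          (h.accepts hv hw hp hk hm hmem)).1 k
        rwa [(h m hm).2.1] at this

/-- A read that remains pending receives replies from each correct process again and again. -/
theorem ReadingFrom.exists_reply {p : P} {R n : ℕ} (h : σ.ReadingFrom p R n) (hf : σ.Fair)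
    (hv : σ.IsVal val) (hw : w ∉ F) (hp : p ∉ F) {k : P} (hk : k ∉ F)
    (hn : Msg.read R ∈ (σ.state n).chan p k) {N : ℕ} (hN : n ≤ N) :
    ∃ m, N ≤ m ∧ ∃ e : Entry X,
      Msg.value R e.pts e.pv e.ts e.v ∈ (σ.state m).chan k p ∧
      ((σ.state (m + 1)).proc p).readlist k = some e ∧
      ∀ t x, ¬ Selects 𝓕 𝓠 p ((σ.state (m + 1)).proc p).readlist t x := by
  obtain ⟨N', hN', a, b, c, d, hmem⟩ : ∃ N', N ≤ N' ∧
      ∃ a b c d, Msg.value R a b c d ∈ (σ.state N').chan k p := by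
    rcases h.in_transit hv hw hp hk hn hN with hmem | h'
    · obtain ⟨m, hm, res, rest, hl, hchan⟩ := hf.eventually_delivered hk hmem
      have := σ.next m
      rw [hl] at this
      exact ⟨m + 1, by omega, this.deliver_read hk hchan⟩
    · exact ⟨N, le_rfl, h'⟩
  obtain ⟨m, hm, res, rest, hl, hchan⟩ := hf.eventually_delivered hp hmem
  have hmem' : Msg.value R a b c d ∈ (σ.state m).chan k p := by simp [hchan]
  have hnm : n ≤ m := by omega
  obtain ⟨-, h2, h3⟩ := (h.deliver_none hnm hl).deliver_value hp hchan
    (h.accepts hv hw hp hk hnm hmem')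
  exact ⟨m, by omega, ⟨a, b, c, d⟩, hmem', h2, h3⟩

/-- If a correct process does not change its state any more, then it is eventually represented
by this state in the read list of a read that remains pending. -/
theorem ReadingFrom.eventually_readlist {p : P} {R n : ℕ} (h : σ.ReadingFrom p R n)
    (hf : σ.Fair) (hv : σ.IsVal val) (hw : w ∉ F) (hp : p ∉ F) {k : P} (hk : k ∉ F)
    (hn : Msg.read R ∈ (σ.state n).chan p k) {T : ℕ}
    (hT : ∀ᶠ m in atTop, ((σ.state m).proc k).pts = T ∧ ((σ.state m).proc k).ts = T) :
    ∀ᶠ m in atTop, ((σ.state m).proc p).readlist k = some ⟨T, val T, T, val T⟩ := by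
  obtain ⟨N, hN⟩ := eventually_atTop.1 hT
  -- Every `value` message satisfying `G`, whatever its read identifier, reports the final state of
  -- `k`. All messages sent by `k` after stabilisation satisfy it.
  let G : Msg X → Prop := fun m =>
    ∀ r a b c d, m = .value r a b c d → (⟨a, b, c, d⟩ : Entry X) = ⟨T, val T, T, val T⟩
  have hG : ∀ m, N ≤ m → ∃ out, ChanStep (σ.step m) k p ((σ.state m).chan k p)
      ((σ.state (m + 1)).chan k p) out ∧ ∀ x ∈ out, G x := by
    intro m hm
    obtain ⟨out, hout, ho⟩ := (σ.next m).chan_cases k p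
    refine ⟨out, hout, ?_⟩
    rintro x hx r a b c d rfl
    obtain ⟨rfl, rfl, rfl, rfl, -⟩ := (ho hk).1 _ _ _ _ _ hx
    have hR := hv.replicaInv hw hk m
    rw [hR.pv_eq, hR.v_eq, (hN m hm).1, (hN m hm).2]
  -- The whole queue at time `N` is flushed, so that no stale reply can overwrite a final one later.
  obtain ⟨N₁, hN₁, q, hq, hqG⟩ := hf.deliver_prefix hp (G := G) ((σ.state N).chan k p) []
    ⟨[], by simp, by simp⟩ hG
  have hfresh : ∀ m, N₁ ≤ m → ∀ x ∈ (σ.state m).chan k p, G x := by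
    intro m hm
    induction m, hm using Nat.le_induction with
    | base => simpa [hq] using hqG
    | succ m hm ih =>
      obtain ⟨out, hout, ho⟩ := hG m (by omega)
      intro x hx
      rcases hout.mem hx with h' | h'
      · exact ih x h'
      · exact ho x h'
  obtain ⟨m, hm, e, hmem, he, -⟩ := h.exists_reply hf hv hw hp hk hn (le_max_left n N₁)
  refine eventually_atTop.2 ⟨m + 1, fun b hb => ?_⟩
  induction b, hb using Nat.le_induction with
  | base =>
    rw [he]
    exact congrArg some (hfresh m (le_of_max_le_right hm) _ hmem _ _ _ _ _ rfl)
  | succ b hb ih =>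
    have hnb : n ≤ b := by have := le_of_max_le_left hm; omega
    have hNb : N₁ ≤ b := by have := le_of_max_le_right hm; omega
    obtain ⟨e', he'⟩ := Option.isSome_iff_exists.1
      ((σ.next b).readlist_isSome (h b hnb).1 (k := k) (by simp [ih]))
    rw [he']
    rcases (σ.next b).readlist_cases he' with h' | h'
    · rw [← h', ih]
    · exact congrArg some (hfresh b hNb _ h' _ _ _ _ _ rfl)

theorem Fair.read_liveness [Finite P] (hf : σ.Fair) (hv : σ.IsVal val)
    (h𝓠 : IsAsymQuorumSystem 𝓕 𝓠) (hw : w ∈ wise 𝓕 F) (hfin : σ.history.FinitelyManyWrites)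
    {p : P} (hp : p ∈ wise 𝓕 F) {n : ℕ} (h : σ.history n = some (p, .readInv)) :
    ∃ m x, σ.history.NextEvent p n m (.readRet x) := by
  have hnext := σ.next n
  rw [σ.history_eq_readInv.1 h] at hnext
  obtain ⟨hph, -, -, hreq⟩ := hnext.invokeRead_inv
  by_cases hret : ∃ m, n + 1 ≤ m ∧ ∃ j x, σ.step m = .deliver j p (some x)
  · obtain ⟨m, hm, j, x, hl⟩ := hret
    obtain ⟨-, -, h3⟩ | ⟨b, h1, -, ⟨j, x, h2⟩, h3⟩ :=
      σ.reading_or_returns hph (show n + 1 ≤ m + 1 by omega)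
    · exact (h3 m hm (by omega) _ (σ.history_eq_readRet.2 ⟨j, hl⟩)).elim
    · exact ⟨b, x, by omega, σ.history_eq_readRet.2 ⟨j, h2⟩, fun k hk => h3 k hk⟩
  exfalso
  push Not at hret
  have hR : σ.ReadingFrom p ((σ.state (n + 1)).proc p).rid (n + 1) := by
    intro m hm
    obtain ⟨h1, h2, -⟩ | ⟨b, h1, -, ⟨j, x, h2⟩, -⟩ := σ.reading_or_returns hph hm
    · exact ⟨h1, h2, hret m hm⟩
    · exact (hret b h1 j x h2).elim
  obtain ⟨T, hT⟩ := hf.eventually_stable hv h𝓠 hw hfin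
  have hall : ∀ᶠ m in atTop, ∀ k, k ∉ F →
      ((σ.state m).proc p).readlist k = some ⟨T, val T, T, val T⟩ := by
    refine eventually_all.2 fun k => ?_
    by_cases hk : k ∈ F
    · simp [hk]
    · simpa [hk] using hR.eventually_readlist hf hv hw.1 hp.1 hk (hreq k)
        (hT.mono fun m hm => hm k hk)
  obtain ⟨N, hN⟩ := eventually_atTop.1 hall
  -- The return condition is evaluated only when a reply is accepted, so one more reply is needed
  -- after the entries have settled. The reader is correct and can supply it itself.
  obtain ⟨m, hm, -, -, -, hsel⟩ :=
    hR.exists_reply hf hv hw.1 hp.1 hp.1 (hreq p) (le_max_left (n + 1) N)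
  obtain ⟨Q, hQ, hQF⟩ := h𝓠.exists_correct_quorum hp
  -- If a fail-prone set `A` contained all correct processes, it would contain the correct quorum
  -- `Q`, and consistency of `Q` with itself would fail.
  obtain ⟨C, hC, hCF⟩ : ∃ C ∈ coreSets (𝓕 p), C ⊆ Fᶜ := by
    refine exists_coreSet_subset fun A hA hFA => ?_
    have hA' : A ∈ downClosure (𝓕 p) := ⟨A, hA, subset_rfl⟩
    exact h𝓠.consistency p p Q hQ Q hQ A ⟨hA', hA'⟩ fun j hj => hFA (hQF j hj.1)
  have hcar : ∀ k, k ∉ F → ∃ e, ((σ.state (m + 1)).proc p).readlist k = some e ∧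
      e.Carries T (val T) := fun k hk =>
    ⟨_, hN (m + 1) (by have := le_of_max_le_right hm; omega) k hk, .inl rfl⟩
  refine hsel T (val T) ⟨⟨C, hC, fun k hk => hcar k (hCF hk)⟩, Q, hQ, fun k hk => ?_⟩
  obtain ⟨e, he, hc⟩ := hcar k (hQF k hk)
  exact ⟨e, he, .inr hc⟩

end Execution

end AsymRegister

theorem mainTheorem3 {P X : Type*} [Finite P] [DecidableEq P]
    (𝓕 : P → Set (Set P)) (h𝓕 : ∀ i, AsymRegister.IsFailProneSystem (𝓕 i))
    (𝓠 : P → Set (Set P)) (h𝓠 : AsymRegister.IsAsymQuorumSystem 𝓕 𝓠)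
    (w : P) (x₀ : X) (F : Set P) (hw : w ∈ AsymRegister.wise 𝓕 F)
    (σ : AsymRegister.Execution 𝓕 𝓠 w x₀ F) (hfair : σ.Fair)
    (hfin : σ.history.FinitelyManyWrites) :
    σ.history.IsRegularRegister (AsymRegister.wise 𝓕 F) x₀ := by
  obtain ⟨val, hv⟩ := σ.exists_isVal
  exact {
    write_liveness := fun _ _ _ _ h => hfair.write_liveness hv h𝓠 hw h
    read_liveness := fun _ hp _ h => hfair.read_liveness hv h𝓠 hw hfin hp h
    safety := fun _ hp _ _ _ h => hv.safety h𝓠 hw hp h }
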